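/- Let $A$ be a finite alphabet with $m=|A|\ge 1$, let $\tilde A=A\cup A^{-1}$, let $\pi:\tilde A^*\to F_A$ be the canonical projection onto the free group on $A$, and let $R_A\subseteq\tilde A^*$ be the set of reduced words. Let $v_1,\dots,v_{m-1}\in R_A$ and put $$X=\{x\in R_A \mid (\pi(v_1),\dots,\pi(v_{m-1}),\pi(x))\ \text{is a basis of } F_A\}.$$ Then: (1) $X$ is a rational subset of $\tilde A^*$, i.e. it is obtained from finite subsets of $\tilde A^*$ by finitely many unions, products and stars; (2) $X$ is effectively constructible: there is an algorithm (a computable function), uniform in $m$, $A$ and the $v_i$, which on input $v_1,\dots,v_{m-1}$ (over the enumerated alphabet $A$) produces a finite automaton recognizing $X$; (3) for every $z\in X$, $X=\{x\in R_A\mid \pi(x)\in V\{\pi(z),\pi(z)^{-1}\}V\}$, where $V=\langle \pi(v_1),\dots,\pi(v_{m-1})\rangle\le F_A$. -/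

import Mathlib

open scoped Pointwise

universe u

/-- The rational subsets of a monoid: those obtained from finite subsets by finitely many unions,
products and stars, where `L* = ⋃ n, L ^ n` and `L ^ 0 = {1}`. -/
inductive IsRational {M : Type u} [Monoid M] : Set M → Prop
  | finite {K : Set M} : K.Finite → IsRational K
  | union {K L : Set M} : IsRational K → IsRational L → IsRational (K ∪ L)
  | mul {K L : Set M} : IsRational K → IsRational L → IsRational (K * L)
  | star {K : Set M} : IsRational K → IsRational (⋃ n : ℕ, K ^ n)

/-- A finite automaton over the alphabet `β`, as a finite piece of data `(q₀, T, E)`: the initial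
state, the list of terminal states, and the list of transitions `(p, a, q)`. The states are natural
numbers, and the finite set of states consists of those that occur in the data. -/
abbrev Automaton (β : Type*) : Type _ := ℕ × List ℕ × List (ℕ × β × ℕ)

/-- `M.Path p w q`: there is a path from `p` to `q` with label `w`. -/
inductive Automaton.Path {β : Type*} (M : Automaton β) : ℕ → List β → ℕ → Prop
  | nil (p : ℕ) : Automaton.Path M p [] p
  | cons {p q r : ℕ} {a : β} {w : List β} :
      (p, a, q) ∈ M.2.2 → Automaton.Path M q w r → Automaton.Path M p (a :: w) r

/-- The set of labels of the successful paths. -/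
def Automaton.language {β : Type*} (M : Automaton β) : Set (List β) :=
  {w | ∃ t ∈ M.2.1, Automaton.Path M M.1 w t}

/-- The family `w` is a basis of the group `G`: the homomorphism from the free group on the index
set that it induces is an isomorphism. -/
def IsFreeBasis {ι G : Type*} [Group G] (w : ι → G) : Prop :=
  Function.Bijective (FreeGroup.lift w)

/-- The set of reduced words `x` such that `(v₁, …, vₙ, x)` is a basis of the free group on `α`.
A word over `α ∪ α⁻¹` is a list of pairs, where `(a, true)` is `a` and `(a, false)` is `a⁻¹`. -/
def basisCompletions {α : Type*} {n : ℕ} (v : Fin n → List (α × Bool)) : Set (List (α × Bool)) :=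
  {x | FreeGroup.IsReduced x ∧
    IsFreeBasis (Fin.snoc (fun i => FreeGroup.mk (v i)) (FreeGroup.mk x) :
      Fin (n + 1) → FreeGroup α)}

/-- The word over `{0, …, n} ∪ {0, …, n}⁻¹` that a word over `α ∪ α⁻¹` becomes when each letter is
replaced by its index in the enumeration `e` of `α`. -/
def codeWord {α : Type*} {n : ℕ} (e : α ≃ Fin (n + 1)) (w : List (α × Bool)) : List (ℕ × Bool) :=
  w.map fun p => ((e p.1 : ℕ), p.2)

/-! Finitely generated free groups are Hopfian (`FreeGroup.injective_of_surjective`), so `m`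
elements form a basis as soon as they generate. With `V` generated by the `v i`, the question is
therefore which `x` generate the group together with `V`.

The heart is `exists_short_connector`. In the coset graph of `V`, let the core be the finite part
that the words `v i` traverse from the base vertex. Any `x` can be written `g⁻¹ * mk Y * h` with `g`
and `h` leading to core vertices, so that `x` attaches an arc labelled `Y` to the core. If a
shortest such `Y` has at least two letters, the two halves of the arc leave the core independently.
Exchanging the ends of two edges of the coset graph joins these halves and gives another action in
which `V` and `x` fix the base vertex but some element moves it. So if `V` and `x` generate, at most
one letter is needed.

For rationality, the property `SplitsIn` survives cancellation. Hence a reduced `x` reads in the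
core before and after a single letter (`exists_core_decomposition`). Such words are labels of paths
through two copies of the core, with one passage from the first copy to the second. Whether `x`
completes `V` depends only on the double coset of `x`, so it can be tested on the passage alone.
This gives a finite automaton, and Kleene's theorem makes its language rational.

The automaton is computable because membership in a finitely generated subgroup is decidable. A
member is certified by a product of generators. A nonmember is certified, by Marshall Hall's
theorem, by finitely many transpositions defining an action in which the subgroup fixes a point and
the element does not.

For the double coset formula, the basis `(v, z)` is carried to the standard one. The core is then a
single vertex, and the connecting letter must be the last generator or its inverse
(`mem_double_coset_of_closure_eq_top`). -/

/-! ### Coset graphs and the exchange of edges -/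

open FreeGroup in
theorem lift_mk_letter_apply {α Ω Ω' : Type*} [MulAction (FreeGroup α) Ω] (ρ : α → Equiv.Perm Ω')
    (ι : Ω → Ω') (C : Set Ω) (B : Set α)
    (h : ∀ b ∈ B, ∀ c ∈ C, of b • c ∈ C → ρ b (ι c) = ι (of b • c))
    (a : α × Bool) (ha : a.1 ∈ B) (c : Ω) (hc : c ∈ C) (hac : mk [a] • c ∈ C) :
    lift ρ (mk [a]) (ι c) = ι (mk [a] • c) := by
  obtain ⟨b, _ | _⟩ := a
  · have e : (mk [(b, false)] : FreeGroup α) = (of b)⁻¹ := rfl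
    rw [e] at hac ⊢
    have := h b ha _ hac (by simpa using hc)
    rw [smul_inv_smul] at this
    rw [_root_.map_inv, lift_apply_of, Equiv.Perm.inv_eq_iff_eq]
    exact this.symm
  · have e : (mk [(b, true)] : FreeGroup α) = of b := rfl
    rw [e] at hac ⊢
    rw [lift_apply_of]
    exact h b ha c hc hac

open FreeGroup in
/-- If the permutations `ρ` act along `ι` as the given action does on the edges inside `C`, then
they do so along every walk inside `C`. -/
theorem lift_mk_apply_of_walk {α Ω Ω' : Type*} [MulAction (FreeGroup α) Ω] (ρ : α → Equiv.Perm Ω')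
    (ι : Ω → Ω') (C : Set Ω) (B : Set α)
    (h : ∀ b ∈ B, ∀ c ∈ C, of b • c ∈ C → ρ b (ι c) = ι (of b • c))
    (w : List (α × Bool)) (hw : ∀ a ∈ w, a.1 ∈ B) (p : Ω)
    (hC : ∀ s, s <:+ w → mk s • p ∈ C) :
    lift ρ (mk w) (ι p) = ι (mk w • p) := by
  induction w with
  | nil => rw [← one_eq_mk]; simp
  | cons a w ih =>
    have e : (mk (a :: w) : FreeGroup α) = mk [a] * mk w := by simp
    have hw' := hC w (List.suffix_cons a w)
    have haw := hC _ List.suffix_rfl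
    rw [e, _root_.map_mul, Equiv.Perm.mul_apply,
      ih (fun b hb => hw b (by simp [hb])) (fun s hs => hC s (hs.trans (List.suffix_cons a w))),
      mul_smul]
    rw [e, mul_smul] at haw
    exact lift_mk_letter_apply ρ ι C B h a (hw a (by simp)) _ hw' haw

/-- A permutation that agrees with `σ` on the edges inside `C`, where the edge from `r` to `r'`
and the edge from `q'` to `q` have exchanged their ends. -/
theorem exists_perm_switch {Ω : Type*} (σ : Equiv.Perm Ω) (C : Set Ω) (r q : Ω)
    (hr : σ r ∉ C) (hq : σ.symm q ∉ C) :
    ∃ τ : Equiv.Perm Ω, (∀ c ∈ C, σ c ∈ C → τ c = σ c) ∧ τ r = q := by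
  classical
  -- The transposition affects only the edges ending at `q` or at `σ r`. The first starts outside
  -- `C` and the second ends outside `C`, so no edge inside `C` changes.
  refine ⟨Equiv.swap q (σ r) * σ, fun c hc hσ => ?_, by simp⟩
  rw [Equiv.Perm.mul_apply]
  refine Equiv.swap_apply_of_ne_of_ne ?_ ?_
  · rintro rfl
    simp [hc] at hq
  · intro h
    exact hr (h ▸ hσ)

open FreeGroup in
theorem exists_switch {α Ω : Type*} [MulAction (FreeGroup α) Ω] (C : Set Ω) (a : α × Bool)
    (r q : Ω) (hr : mk [a] • r ∉ C) (hq : (mk [a])⁻¹ • q ∉ C) :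
    ∃ ρ : α → Equiv.Perm Ω, (∀ b, ∀ c ∈ C, of b • c ∈ C → ρ b c = of b • c) ∧
      lift ρ (mk [a]) r = q := by
  classical
  obtain ⟨b, ε⟩ := a
  have key : ∀ τ : Equiv.Perm Ω, (∀ c ∈ C, of b • c ∈ C → τ c = of b • c) →
      ∀ b', ∀ c ∈ C, of b' • c ∈ C →
        Function.update (fun b => MulAction.toPerm (of b : FreeGroup α)) b τ b' c = of b' • c := by
    intro τ hτ b' c hc hb'
    rcases eq_or_ne b' b with rfl | hb
    · simpa using hτ c hc hb'
    · simp [Function.update_of_ne hb]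
  cases ε
  · have e : (mk [(b, false)] : FreeGroup α) = (of b)⁻¹ := rfl
    rw [e] at hr hq ⊢
    rw [inv_inv] at hq
    -- An inverse letter traverses the edge backwards, so the permutation of `b` has to send `q` to
    -- `r`.
    obtain ⟨τ, h1, h2⟩ := exists_perm_switch (MulAction.toPerm (of b : FreeGroup α)) C q r hq hr
    exact ⟨_, key τ h1, by simp [Equiv.symm_apply_eq, h2]⟩
  · have e : (mk [(b, true)] : FreeGroup α) = of b := rfl
    rw [e] at hr hq ⊢
    obtain ⟨τ, h1, h2⟩ := exists_perm_switch (MulAction.toPerm (of b : FreeGroup α)) C r q hr hq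
    exact ⟨_, key τ h1, by simp [h2]⟩

/-- The letter `a` is a middle edge of the arc, where the exchange takes place. The letter `b` is
singled out because it leads to a vertex of the arc at distance one from the core. -/
theorem exists_balanced_split {β : Type*} (Y : List β) (hY : 2 ≤ Y.length) :
    ∃ Y₁ a b Y₂, Y = Y₁ ++ a :: (Y₂ ++ [b]) ∧ Y₁.length ≤ Y₂.length + 1 ∧
      Y₂.length ≤ Y₁.length := by
  set k := (Y.length - 1) / 2 with hk
  have h1 : Y = Y.take k ++ Y.drop k := (List.take_append_drop k Y).symm
  have hl : (Y.take k).length = k := by rw [List.length_take]; omega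
  cases h2 : Y.drop k with
  | nil => rw [List.drop_eq_nil_iff] at h2; omega
  | cons a Z =>
    have h3 : Z.length + 1 = Y.length - k := by
      rw [← List.length_drop, h2, List.length_cons]
    rcases List.eq_nil_or_concat' Z with rfl | ⟨Y₂, b, rfl⟩
    · simp at h3; omega
    · refine ⟨Y.take k, a, b, Y₂, by rw [← h2]; exact h1, ?_, ?_⟩ <;>
      · simp at h3; omega

open FreeGroup in
/-- If the subgroup `V` and the element `x` generate the free group, then `x` arises, up to at most
one letter, from joining two vertices of the core `C₀` of the coset graph of `V`. -/
theorem exists_short_connector {α : Type*} (V : Subgroup (FreeGroup α))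
    (gens : Set (List (α × Bool))) (hV : V = Subgroup.closure (mk '' gens))
    (C₀ : Set (FreeGroup α ⧸ V)) (h1 : ((1 : FreeGroup α) : FreeGroup α ⧸ V) ∈ C₀)
    (hgen : ∀ v ∈ gens, ∀ s, s <:+ v → ((mk s : FreeGroup α) : FreeGroup α ⧸ V) ∈ C₀)
    (hconn : ∀ c ∈ C₀, ∃ s, ((mk s : FreeGroup α) : FreeGroup α ⧸ V) = c ∧
      ∀ s', s' <:+ s → ((mk s' : FreeGroup α) : FreeGroup α ⧸ V) ∈ C₀)
    (x : FreeGroup α) (hx : Subgroup.closure (insert x (V : Set (FreeGroup α))) = ⊤) :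
    ∃ g h : FreeGroup α, ∃ Y : List (α × Bool), Y.length ≤ 1 ∧ x = g⁻¹ * mk Y * h ∧
      (g : FreeGroup α ⧸ V) ∈ C₀ ∧ (h : FreeGroup α ⧸ V) ∈ C₀ := by
  classical
  let Conn : ℕ → Prop := fun L => ∃ g h : FreeGroup α, ∃ Y : List (α × Bool), Y.length = L ∧
    x = g⁻¹ * mk Y * h ∧ (g : FreeGroup α ⧸ V) ∈ C₀ ∧ (h : FreeGroup α ⧸ V) ∈ C₀
  have hex : ∃ L, Conn L := ⟨_, 1, 1, x.toWord, rfl, by simp [mk_toWord], h1, h1⟩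
  have hmin : ∀ g h : FreeGroup α, ∀ Y : List (α × Bool), x = g⁻¹ * mk Y * h →
      (g : FreeGroup α ⧸ V) ∈ C₀ → (h : FreeGroup α ⧸ V) ∈ C₀ → Nat.find hex ≤ Y.length :=
    fun g h Y e hg hh => Nat.find_min' hex ⟨g, h, Y, rfl, e, hg, hh⟩
  obtain ⟨g₀, h₀, Y, hYL, hxY, hg₀, hh₀⟩ := Nat.find_spec hex
  by_cases hlt : Y.length ≤ 1
  · exact ⟨g₀, h₀, Y, hlt, hxY, hg₀, hh₀⟩
  exfalso
  push Not at hlt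
  rw [← hYL] at hmin
  obtain ⟨g, hg, hgC⟩ := hconn _ hg₀
  obtain ⟨h, hh, hhC⟩ := hconn _ hh₀
  -- distances from the core along `Y`
  have dist_h : ∀ Y' s Z : List (α × Bool), ∀ h' : FreeGroup α, Y = Y' ++ s →
      (h' : FreeGroup α ⧸ V) ∈ C₀ →
      ((mk s * h₀ : FreeGroup α) : FreeGroup α ⧸ V) = ((mk Z * h' : FreeGroup α) : FreeGroup α ⧸ V) →
      s.length ≤ Z.length := by
    intro Y' s Z h' e hh' hs
    obtain ⟨v, hv⟩ : ∃ v : V, mk s * h₀ * v = mk Z * h' :=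
      ⟨⟨_, QuotientGroup.eq.1 hs⟩, mul_inv_cancel_left _ _⟩
    -- A shorter way `Z` from the core to this vertex could replace `s` and shorten the connector.
    have := hmin g₀ (h' * (v : FreeGroup α)⁻¹) (Y' ++ Z) (by
      have : mk Z * (h' * (v : FreeGroup α)⁻¹) = mk s * h₀ := by
        rw [← mul_assoc, ← hv, mul_inv_cancel_right]
      rw [hxY, e, ← mul_mk, ← mul_mk, mul_assoc, mul_assoc, mul_assoc, mul_assoc, this]) hg₀ (by
        rwa [QuotientGroup.mk_mul_of_mem _ (V.inv_mem v.2)])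
    rw [e, List.length_append, List.length_append] at this
    omega
  have dist_g : ∀ Y' t Z : List (α × Bool), ∀ h' : FreeGroup α, Y = t ++ Y' →
      (h' : FreeGroup α ⧸ V) ∈ C₀ →
      (((mk t)⁻¹ * g₀ : FreeGroup α) : FreeGroup α ⧸ V) =
        ((mk Z * h' : FreeGroup α) : FreeGroup α ⧸ V) →
      t.length ≤ Z.length := by
    intro Y' t Z h' e hh' hs
    obtain ⟨v, hv⟩ : ∃ v : V, (mk t)⁻¹ * g₀ * v = mk Z * h' :=
      ⟨⟨_, QuotientGroup.eq.1 hs⟩, mul_inv_cancel_left _ _⟩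
    have hg' : g₀ = mk t * (mk Z * h') * (v : FreeGroup α)⁻¹ := by rw [← hv]; group
    have := hmin (h' * (v : FreeGroup α)⁻¹) h₀ (invRev Z ++ Y') (by
      rw [hxY, e, ← mul_mk, ← mul_mk, hg', ← inv_mk]; group) (by
        rwa [QuotientGroup.mk_mul_of_mem _ (V.inv_mem v.2)]) hh₀
    rw [e, List.length_append, List.length_append, invRev_length] at this
    omega
  obtain ⟨Y₁, a, b, Y₃, hY, hl1, hl2⟩ := exists_balanced_split Y hlt
  have hY' : Y = (Y₁ ++ a :: Y₃) ++ [b] := by rw [hY]; simp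
  set Y₂ := Y₃ ++ [b] with hY₂
  have hl3 : Y₂.length = Y₃.length + 1 := by simp [hY₂]
  have hY'' : Y = (Y₁ ++ [a]) ++ Y₂ := by rw [hY]; simp
  -- The core with the two halves of the arc attached, the edge `a` between them being left out.
  let C : Set (FreeGroup α ⧸ V) := {c | c ∈ C₀ ∨
    (∃ s, s <:+ Y₂ ∧ c = ((mk s * h₀ : FreeGroup α) : FreeGroup α ⧸ V)) ∨
    ∃ t, t <+: Y₁ ∧ c = (((mk t)⁻¹ * g₀ : FreeGroup α) : FreeGroup α ⧸ V)}
  have hr : mk [a] • ((mk Y₂ * h₀ : FreeGroup α) : FreeGroup α ⧸ V) ∉ C := by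
    have e : mk [a] • ((mk Y₂ * h₀ : FreeGroup α) : FreeGroup α ⧸ V) =
        ((mk (a :: Y₂) * h₀ : FreeGroup α) : FreeGroup α ⧸ V) := by
      rw [MulAction.Quotient.smul_coe, smul_eq_mul, ← mul_assoc, mul_mk, List.singleton_append]
    have key := fun Z h' h1 h2 => dist_h Y₁ (a :: Y₂) Z h' hY h1 h2
    rw [e]
    rintro (hc | ⟨s, hs, hc⟩ | ⟨t, ht, hc⟩)
    · obtain ⟨h', hh'⟩ := QuotientGroup.mk_surjective
        ((mk (a :: Y₂) * h₀ : FreeGroup α) : FreeGroup α ⧸ V)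
      have := key [] h' (hh' ▸ hc) (by rw [← one_eq_mk, one_mul, hh'])
      simp at this
    · have := key s h₀ hh₀ hc
      have := hs.length_le
      simp at *; omega
    · have := key (invRev t) g₀ hg₀ (by rwa [← inv_mk])
      have := ht.length_le
      simp [invRev_length] at *; omega
  have hq : (mk [a])⁻¹ • (((mk Y₁)⁻¹ * g₀ : FreeGroup α) : FreeGroup α ⧸ V) ∉ C := by
    have e : (mk [a])⁻¹ • (((mk Y₁)⁻¹ * g₀ : FreeGroup α) : FreeGroup α ⧸ V) =
        (((mk (Y₁ ++ [a]))⁻¹ * g₀ : FreeGroup α) : FreeGroup α ⧸ V) := by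
      rw [MulAction.Quotient.smul_coe, smul_eq_mul, ← mul_assoc, ← mul_mk, mul_inv_rev]
    have key := fun Z h' h1 h2 => dist_g Y₂ (Y₁ ++ [a]) Z h' hY'' h1 h2
    rw [e]
    rintro (hc | ⟨s, hs, hc⟩ | ⟨t, ht, hc⟩)
    · obtain ⟨h', hh'⟩ := QuotientGroup.mk_surjective
        (((mk (Y₁ ++ [a]))⁻¹ * g₀ : FreeGroup α) : FreeGroup α ⧸ V)
      have := key [] h' (hh' ▸ hc) (by rw [← one_eq_mk, one_mul, hh'])
      simp at this
    -- Distances allow this coincidence only when `s` is all of `Y₂`. Then the arc already closes up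
    -- in the coset graph, so `x ∈ V` and the empty word is a connector.
    · have h3 := key s h₀ hh₀ hc
      have h4 := hs.length_le
      rw [List.length_append, List.length_singleton] at h3
      have h5 : s = Y₂ := hs.eq_of_length (by omega)
      subst h5
      have h6 : x ∈ V := by
        convert QuotientGroup.eq.1 hc using 1
        rw [hxY, hY'', ← mul_mk]
        group
      have := hmin 1 x [] (by simp [← one_eq_mk]) h1 (by
        have : (x : FreeGroup α ⧸ V) = ((1 : FreeGroup α) : FreeGroup α ⧸ V) :=
          QuotientGroup.eq.2 (by simpa using h6)
        rwa [this])
      rw [List.length_nil] at this; omega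
    · have h3 := key (invRev t) g₀ hg₀ (by rwa [← inv_mk])
      have h4 := ht.length_le
      simp [invRev_length] at h3; omega
  -- In the new action the letter `a` joins the two halves, while every walk inside `C` is as
  -- before. Thus `V` and `x` both fix the base vertex.
  obtain ⟨ρ, hρ, hρa⟩ := exists_switch C a _ _ hr hq
  have walk := lift_mk_apply_of_walk ρ id C Set.univ (fun b _ => hρ b)
  simp only [Set.mem_univ, implies_true, id_eq, forall_const] at walk
  set base : FreeGroup α ⧸ V := ((1 : FreeGroup α) : FreeGroup α ⧸ V) with hbase
  have walk₀ : ∀ s, (∀ s', s' <:+ s → ((mk s' : FreeGroup α) : FreeGroup α ⧸ V) ∈ C₀) →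
      lift ρ (mk s) base = ((mk s : FreeGroup α) : FreeGroup α ⧸ V) := by
    intro s hs
    rw [walk s base fun s' hs' => Or.inl ?_, hbase, MulAction.Quotient.smul_coe, smul_eq_mul,
      mul_one]
    rw [hbase, MulAction.Quotient.smul_coe, smul_eq_mul, mul_one]
    exact hs s' hs'
  let S : Subgroup (FreeGroup α) := (MulAction.stabilizer (Equiv.Perm _) base).comap (lift ρ)
  have hVS : V ≤ S := by
    rw [hV, Subgroup.closure_le]
    rintro _ ⟨v, hv, rfl⟩
    have hvV : mk v ∈ V := hV ▸ Subgroup.subset_closure (Set.mem_image_of_mem _ hv)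
    refine (walk₀ v (hgen v hv)).trans ?_
    exact QuotientGroup.eq.2 (by simpa using V.inv_mem hvV)
  have hh₀S : lift ρ (mk h) base = (h₀ : FreeGroup α ⧸ V) := (walk₀ h hhC).trans hh
  have hg₀S : lift ρ (mk g) base = (g₀ : FreeGroup α ⧸ V) := (walk₀ g hgC).trans hg
  obtain ⟨v, hv⟩ : ∃ v : V, mk h * v = h₀ := ⟨⟨_, QuotientGroup.eq.1 hh⟩, mul_inv_cancel_left _ _⟩
  obtain ⟨v', hv'⟩ : ∃ v' : V, mk g * v' = g₀ :=
    ⟨⟨_, QuotientGroup.eq.1 hg⟩, mul_inv_cancel_left _ _⟩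
  have hxS : x ∈ S := by
    have h2 : lift ρ (mk Y₂) (h₀ : FreeGroup α ⧸ V) =
        ((mk Y₂ * h₀ : FreeGroup α) : FreeGroup α ⧸ V) := walk Y₂ (h₀ : FreeGroup α ⧸ V)
      fun s hs => Or.inr (Or.inl ⟨s, hs, rfl⟩)
    have h3 : lift ρ (mk Y₁) (((mk Y₁)⁻¹ * g₀ : FreeGroup α) : FreeGroup α ⧸ V) =
        (g₀ : FreeGroup α ⧸ V) := by
      rw [walk Y₁, MulAction.Quotient.smul_coe, smul_eq_mul, mul_inv_cancel_left]
      rintro s ⟨t, rfl⟩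
      refine Or.inr (Or.inr ⟨t, List.prefix_append _ _, ?_⟩)
      rw [MulAction.Quotient.smul_coe, smul_eq_mul, ← mul_mk, mul_inv_rev, ← mul_assoc,
        mul_inv_cancel_left]
    have h4 : lift ρ ((mk g)⁻¹ * mk Y * mk h) base = base := by
      rw [hY'', ← mul_mk, ← mul_mk]
      simp only [_root_.map_mul, _root_.map_inv, Equiv.Perm.mul_apply]
      rw [hh₀S, h2, hρa, h3, ← hg₀S, Equiv.Perm.inv_eq_iff_eq]
    have h5 : x = (v' : FreeGroup α)⁻¹ * ((mk g)⁻¹ * mk Y * mk h) * v := by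
      rw [hxY, ← hv, ← hv']; group
    rw [h5]
    exact S.mul_mem (S.mul_mem (S.inv_mem (hVS v'.2)) h4) (hVS v.2)
  have hS : S = ⊤ := by
    rw [eq_top_iff, ← hx, Subgroup.closure_le]
    exact Set.insert_subset hxS hVS
  -- The contradiction: this element leads from the base vertex to the first vertex of the arc,
  -- which is off the core, yet it would have to fix the base vertex.
  have hbS : mk [b] * mk h ∈ S := hS ▸ Subgroup.mem_top _
  have hb : lift ρ (mk [b] * mk h) base = base := hbS
  rw [_root_.map_mul, Equiv.Perm.mul_apply, hh₀S, walk [b]] at hb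
  · have := dist_h (Y₁ ++ a :: Y₃) [b] [] 1 hY' h1 (by
      rw [← one_eq_mk, one_mul]; exact hb)
    simp at this
  · intro s hs
    rw [MulAction.Quotient.smul_coe, smul_eq_mul]
    exact Or.inr (Or.inl ⟨s, hs.trans (List.suffix_append _ _), rfl⟩)

/-! ### Marshall Hall's theorem, residual finiteness and the Hopf property -/

/-- The permutations, one for each letter, that a list of transpositions labelled by letters
defines. -/
def swapPerm {α Ω : Type*} [DecidableEq α] [DecidableEq Ω] (c : List (α × Ω × Ω)) (a : α) :
    Equiv.Perm Ω :=
  c.foldr (fun t σ => if t.1 = a then Equiv.swap t.2.1 t.2.2 * σ else σ) 1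

theorem swapPerm_cons {α Ω : Type*} [DecidableEq α] [DecidableEq Ω] (t : α × Ω × Ω)
    (c : List (α × Ω × Ω)) (a : α) : swapPerm (t :: c) a =
      if t.1 = a then Equiv.swap t.2.1 t.2.2 * swapPerm c a else swapPerm c a := rfl

/-- Finitely many edges that are injective at both ends extend to permutations. -/
theorem exists_swapPerm_extending {α Ω : Type*} [DecidableEq α] [DecidableEq Ω]
    (E : List (α × Ω × Ω))
    (hE : ∀ a p q p' q', (a, p, q) ∈ E → (a, p', q') ∈ E → (p = p' ↔ q = q')) :
    ∃ c : List (α × Ω × Ω), ∀ a p q, (a, p, q) ∈ E → swapPerm c a p = q := by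
  induction E with
  | nil => exact ⟨[], by simp⟩
  | cons t E ih =>
    obtain ⟨c, hc⟩ := ih fun a p q p' q' h h' =>
      hE a p q p' q' (List.mem_cons_of_mem _ h) (List.mem_cons_of_mem _ h')
    by_cases ht : t ∈ E
    · refine ⟨c, fun a p q h => ?_⟩
      rcases List.mem_cons.1 h with rfl | h
      exacts [hc _ _ _ ht, hc _ _ _ h]
    · obtain ⟨a, p, q⟩ := t
      -- The transposition of the present image of `p` with `q` realizes the new edge. By
      -- injectivity at both ends, no other edge labelled `a` ends at either of these two points.
      refine ⟨(a, swapPerm c a p, q) :: c, fun a' p' q' h => ?_⟩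
      rw [swapPerm_cons]
      rcases List.mem_cons.1 h with h' | h'
      · obtain ⟨rfl, rfl, rfl⟩ : a' = a ∧ p' = p ∧ q' = q := by simpa using h'
        simp
      · have h1 := hc _ _ _ h'
        split_ifs with haa
        · obtain rfl : a = a' := haa
          have h2 := hE a p q p' q' List.mem_cons_self h
          have hq : q' ≠ q := by
            rintro rfl
            obtain rfl := h2.2 rfl
            exact ht h'
          have hp : q' ≠ swapPerm c a p := by
            intro e
            rw [← h1] at e
            exact hq (h2.1 ((swapPerm c a).injective e).symm).symm
          rw [Equiv.Perm.mul_apply, h1, Equiv.swap_apply_of_ne_of_ne hp hq]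
        · exact h1

/-- The vertices of the coset graph of `V` on the walks labelled by the words in `W`. -/
def walkCosets {α : Type*} (V : Subgroup (FreeGroup α)) (W : List (List (α × Bool))) :
    Set (FreeGroup α ⧸ V) :=
  {c | ∃ w ∈ W, ∃ s, s <:+ w ∧ c = ((FreeGroup.mk s : FreeGroup α) : FreeGroup α ⧸ V)}

theorem walkCosets_finite {α : Type*} (V : Subgroup (FreeGroup α)) (W : List (List (α × Bool))) :
    (walkCosets V W).Finite := by
  refine ((W.flatMap List.tails).finite_toSet.image
    fun s => ((FreeGroup.mk s : FreeGroup α) : FreeGroup α ⧸ V)).subset ?_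
  rintro _ ⟨w, hw, s, hs, rfl⟩
  exact ⟨s, by simpa using ⟨w, hw, hs⟩, rfl⟩

open FreeGroup in
theorem exists_swapPerm_walks {α Ω : Type*} [DecidableEq α] [DecidableEq Ω]
    (V : Subgroup (FreeGroup α)) (W : List (List (α × Bool))) (ι : FreeGroup α ⧸ V → Ω)
    (hι : Set.InjOn ι (walkCosets V W)) :
    ∃ c : List (α × Ω × Ω), ∀ w ∈ W,
      lift (swapPerm c) (mk w) (ι ((1 : FreeGroup α) : FreeGroup α ⧸ V)) =
        ι ((mk w : FreeGroup α) : FreeGroup α ⧸ V) := by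
  classical
  let B : Set α := {b | b ∈ (W.flatten.map Prod.fst)}
  have hB : B.Finite := List.finite_toSet _
  let E : Set (α × Ω × Ω) := {t | ∃ b ∈ B, ∃ c ∈ walkCosets V W, of b • c ∈ walkCosets V W ∧
    t = (b, ι c, ι (of b • c))}
  have hEfin : E.Finite := by
    refine ((hB.prod (walkCosets_finite V W)).image
      fun t => (t.1, ι t.2, ι (of t.1 • t.2))).subset ?_
    rintro _ ⟨b, hb, c, hc, -, rfl⟩
    exact ⟨(b, c), ⟨hb, hc⟩, rfl⟩
  obtain ⟨c, hc⟩ := exists_swapPerm_extending hEfin.toFinset.toList (by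
    intro a p q p' q' h h'
    rw [Finset.mem_toList, Set.Finite.mem_toFinset] at h h'
    obtain ⟨b, hb, c, hc, hbc, h⟩ := h
    obtain ⟨b', hb', c', hc', hbc', h'⟩ := h'
    simp only [Prod.mk.injEq] at h h'
    obtain ⟨rfl, rfl, rfl⟩ := h
    obtain ⟨rfl, rfl, rfl⟩ := h'
    rw [hι.eq_iff hc hc', hι.eq_iff hbc hbc', smul_left_cancel_iff])
  refine ⟨c, fun w hw => ?_⟩
  have := lift_mk_apply_of_walk (swapPerm c) ι (walkCosets V W) B (fun b hb p hp hbp => hc b _ _ (by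
      rw [Finset.mem_toList, Set.Finite.mem_toFinset]
      exact ⟨b, hb, p, hp, hbp, rfl⟩)) w (fun a ha => by
        simp only [B, Set.mem_ofPred_eq, List.mem_map, List.mem_flatten]
        exact ⟨a, ⟨w, hw, ha⟩, rfl⟩) ((1 : FreeGroup α) : FreeGroup α ⧸ V) (fun s hs => by
        rw [MulAction.Quotient.smul_coe, smul_eq_mul, mul_one]
        exact ⟨w, hw, s, hs, rfl⟩)
  rwa [MulAction.Quotient.smul_coe, smul_eq_mul, mul_one] at this

open FreeGroup in
/-- **Marshall Hall's theorem**: finitely generated subgroups of free groups are separable. -/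
theorem exists_swapPerm_separating {α Ω : Type*} [DecidableEq α] [DecidableEq Ω]
    (V : Subgroup (FreeGroup α)) (L : List (List (α × Bool))) (hL : ∀ v ∈ L, mk v ∈ V)
    (g : List (α × Bool)) (hg : mk g ∉ V) (ι : FreeGroup α ⧸ V → Ω)
    (hι : Set.InjOn ι (walkCosets V (g :: L))) :
    ∃ c : List (α × Ω × Ω), ∃ o : Ω, (∀ v ∈ L, lift (swapPerm c) (mk v) o = o) ∧
      lift (swapPerm c) (mk g) o ≠ o := by
  obtain ⟨c, hc⟩ := exists_swapPerm_walks V (g :: L) ι hι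
  refine ⟨c, ι ((1 : FreeGroup α) : FreeGroup α ⧸ V), fun v hv => ?_, ?_⟩
  · rw [hc v (List.mem_cons_of_mem _ hv)]
    congr 1
    exact QuotientGroup.eq.2 (by simpa using V.inv_mem (hL v hv))
  · rw [hc g List.mem_cons_self]
    intro h
    have := hι ⟨g, List.mem_cons_self, g, List.suffix_rfl, rfl⟩
      ⟨g, List.mem_cons_self, [], List.nil_suffix, rfl⟩ h
    have := V.inv_mem (QuotientGroup.eq.1 this)
    rw [← one_eq_mk] at this
    exact hg (by simpa using this)

open FreeGroup in
/-- Free groups are residually finite. -/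
theorem exists_finite_perm_ne_one {α : Type u} (g : FreeGroup α) (hg : g ≠ 1) :
    ∃ (Ω : Type u) (_ : Finite Ω) (ρ : FreeGroup α →* Equiv.Perm Ω), ρ g ≠ 1 := by
  classical
  set W := [g.toWord] with hW
  have h0 : ((1 : FreeGroup α) : FreeGroup α ⧸ (⊥ : Subgroup (FreeGroup α))) ∈ walkCosets ⊥ W :=
    ⟨g.toWord, by simp [hW], [], List.nil_suffix, rfl⟩
  -- Only the vertices on the walk need distinct labels, so a finite label set suffices. All other
  -- cosets get the label of the base vertex as a dummy value.
  obtain ⟨c, o, -, h⟩ := exists_swapPerm_separating (⊥ : Subgroup (FreeGroup α)) [] (by simp)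
    g.toWord (by simpa [mk_toWord] using hg)
    (fun c => if h : c ∈ walkCosets ⊥ W then (⟨c, h⟩ : walkCosets ⊥ W) else ⟨_, h0⟩) (by
      intro c hc d hd h
      simpa [hW, hc, hd] using h)
  refine ⟨walkCosets ⊥ W, walkCosets_finite _ _, lift (swapPerm c), fun h' => h ?_⟩
  rw [mk_toWord, h', Equiv.Perm.one_apply]

/-- Finitely generated free groups are Hopfian. -/
theorem FreeGroup.injective_of_surjective {α : Type*} [Finite α]
    (φ : FreeGroup α →* FreeGroup α) (hφ : Function.Surjective φ) : Function.Injective φ := by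
  rw [injective_iff_map_eq_one]
  intro g hg
  by_contra hne
  obtain ⟨Ω, _, ρ, hρ⟩ := exists_finite_perm_ne_one g hne
  have : Finite (FreeGroup α →* Equiv.Perm Ω) := Finite.of_equiv _ FreeGroup.lift
  have hinj : Function.Injective fun ψ : FreeGroup α →* Equiv.Perm Ω => ψ.comp φ :=
    -- Composition with `φ` is an injective self-map of a finite set of homomorphisms, hence
    -- surjective. So `ρ` factors through `φ` and cannot detect an element of its kernel.
    fun ψ ψ' h => (MonoidHom.cancel_right hφ).1 h
  obtain ⟨ψ, rfl⟩ := Finite.surjective_of_injective hinj ρ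
  exact hρ (by simp [hg])

theorem isFreeBasis_iff_closure_eq_top {α ι : Type*} [Finite α] (e : α ≃ ι)
    (w : ι → FreeGroup α) : IsFreeBasis w ↔ Subgroup.closure (Set.range w) = ⊤ := by
  rw [IsFreeBasis, ← FreeGroup.range_lift_eq_closure, MonoidHom.range_eq_top]
  refine ⟨fun h => h.2, fun h => ⟨?_, h⟩⟩
  have := FreeGroup.injective_of_surjective
    ((FreeGroup.lift w).comp (FreeGroup.freeGroupCongr e).toMonoidHom)
    (h.comp (FreeGroup.freeGroupCongr e).surjective)
  rw [MonoidHom.coe_comp] at this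
  exact Function.Injective.of_comp_right this (FreeGroup.freeGroupCongr e).surjective

/-! ### Certificates and computability -/

theorem REPred.of_exists_primrec {α β : Type*} [Primcodable α] [Primcodable β]
    {R : α → β → Prop} (hR : PrimrecRel R) : REPred fun a => ∃ b, R a b := by
  classical
  have h : Primrec₂ fun (a : α) (n : ℕ) =>
      ((Encodable.decode n : Option β).map fun b => decide (R a b)).getD false :=
    Primrec.option_getD.comp (Primrec.option_map (Primrec.decode.comp Primrec.snd)
      (hR.decide.comp (Primrec.fst.comp Primrec.fst) Primrec.snd)) (Primrec.const false)
  -- An unbounded search through the codes of certificates halts exactly when a certificate exists.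
  refine (Partrec.rfind h.to_comp.partrec₂).dom_re.of_eq fun a => ?_
  rw [Nat.rfind_dom']
  constructor
  · rintro ⟨n, hn, -⟩
    cases hd : (Encodable.decode n : Option β) with
    | none => simp [hd] at hn
    | some b => exact ⟨b, by simpa [hd] using hn⟩
  · rintro ⟨b, hb⟩
    exact ⟨Encodable.encode b, by simp [hb], fun _ => trivial⟩

/-- A predicate is computable if it and its negation have certificates that can be checked. -/
theorem ComputablePred.of_certificates {α β γ : Type*} [Primcodable α] [Primcodable β]
    [Primcodable γ] {p : α → Prop} {R : α → β → Prop} {S : α → γ → Prop} (hR : PrimrecRel R)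
    (hS : PrimrecRel S) (hp : ∀ a, p a ↔ ∃ b, R a b) (hn : ∀ a, ¬p a ↔ ∃ c, S a c) :
    ComputablePred p :=
  ComputablePred.computable_iff_re_compl_re'.2
    ⟨(REPred.of_exists_primrec hR).of_eq fun a => (hp a).symm,
      (REPred.of_exists_primrec hS).of_eq fun a => (hn a).symm⟩

theorem Computable.list_filter {α β : Type*} [Primcodable α] [Primcodable β] {f : α → List β}
    {p : α → β → Bool} (hf : Computable f) (hp : Computable₂ p) :
    Computable fun a => (f a).filter (p a) := by
  have h : Computable₂ fun (a : α) (i : ℕ × List β) =>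
      i.2 ++ (((f a)[i.1]?).bind fun b => bif p a b then some b else none).toList :=
    Computable.list_append.comp (Computable.snd.comp Computable.snd)
      (Primrec.optionToList.to_comp.comp
        (Computable.option_bind
          (Computable.list_getElem?.comp (hf.comp Computable.fst)
            (Computable.fst.comp Computable.snd))
          (Computable.cond (hp.comp (Computable.fst.comp Computable.fst) Computable.snd)
            (Computable.option_some.comp Computable.snd) (Computable.const none)).to₂))
  refine (Computable.nat_rec (Computable.list_length.comp hf) (Computable.const []) h).of_eq
    fun a => ?_
  have key : ∀ n : ℕ, (Nat.rec [] (fun y IH => IH ++ (((f a)[y]?).bind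
      fun b => bif p a b then some b else none).toList) n : List β) = ((f a).take n).filter (p a) := by
    intro n
    induction n with
    | zero => simp
    | succ n ih =>
      change _ ++ _ = _
      rw [ih, List.take_add_one, List.filter_append]
      congr 1
      cases (f a)[n]? with
      | none => rfl
      | some b => cases hb : p a b <;> simp [hb]
  exact (key _).trans (by rw [List.take_length])

/-! ### The membership problem for finitely generated subgroups -/

section
open FreeGroup

/-- The reduction of `a :: w`, where `w` is reduced. -/
def cancelCons {α : Type*} [DecidableEq α] (a : α × Bool) (w : List (α × Bool)) :
    List (α × Bool) :=
  if w.head? = some (a.1, !a.2) then w.tail else a :: w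

theorem reduce_eq_foldr {α : Type*} [DecidableEq α] (w : List (α × Bool)) :
    reduce w = w.foldr cancelCons [] := by
  induction w with
  | nil => rfl
  | cons a w ih =>
    rw [reduce.cons, List.foldr_cons, ← ih]
    cases reduce w with
    | nil => simp [cancelCons]
    | cons b w =>
      obtain ⟨a, ε⟩ := a
      obtain ⟨b, δ⟩ := b
      simp only [cancelCons, List.head?_cons, Option.some.injEq, Prod.mk.injEq, List.tail_cons]
      congr 1
      cases ε <;> cases δ <;> simp [eq_comm]

theorem primrec_reduce : Primrec (reduce : List (ℕ × Bool) → List (ℕ × Bool)) := by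
  have h : Primrec₂ (cancelCons : ℕ × Bool → List (ℕ × Bool) → List (ℕ × Bool)) :=
    Primrec.ite (Primrec.eq.comp (Primrec.list_head?.comp Primrec.snd)
        (Primrec.option_some.comp (Primrec.pair (Primrec.fst.comp Primrec.fst)
          (Primrec.not.comp (Primrec.snd.comp Primrec.fst)))))
      (Primrec.list_tail.comp Primrec.snd) (Primrec.list_cons.comp Primrec.fst Primrec.snd)
  exact (Primrec.list_foldr Primrec.id (Primrec.const [])
    (h.comp (Primrec.fst.comp Primrec.snd) (Primrec.snd.comp Primrec.snd)).to₂).of_eq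
    fun w => (reduce_eq_foldr w).symm

theorem primrec_invRev : Primrec (invRev : List (ℕ × Bool) → List (ℕ × Bool)) :=
  Primrec.list_reverse.comp (Primrec.list_map Primrec.id
    (Primrec.pair (Primrec.fst.comp Primrec.snd)
      (Primrec.not.comp (Primrec.snd.comp Primrec.snd))))

/-- The action of the transposition `t` if its label is `a`. -/
def swapStep (a : ℕ) (t : ℕ × ℕ × ℕ) (o : ℕ) : ℕ :=
  if t.1 = a then if o = t.2.1 then t.2.2 else if o = t.2.2 then t.2.1 else o else o

/-- The action of a letter, computed from a list of transpositions. -/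
def actLetter (c : List (ℕ × ℕ × ℕ)) (a : ℕ × Bool) (o : ℕ) : ℕ :=
  if a.2 = true then c.foldr (swapStep a.1) o else c.foldl (fun o t => swapStep a.1 t o) o

/-- The action of a word, computed from a list of transpositions. -/
def actWord (c : List (ℕ × ℕ × ℕ)) (w : List (ℕ × Bool)) (o : ℕ) : ℕ :=
  w.foldr (actLetter c) o

theorem swapStep_eq (a : ℕ) (t : ℕ × ℕ × ℕ) (o : ℕ) :
    swapStep a t o = (if t.1 = a then Equiv.swap t.2.1 t.2.2 else 1 : Equiv.Perm ℕ) o := by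
  unfold swapStep
  split_ifs <;> simp_all [Equiv.swap_apply_def]

theorem foldr_swapStep (c : List (ℕ × ℕ × ℕ)) (a o : ℕ) :
    c.foldr (swapStep a) o = swapPerm c a o := by
  induction c with
  | nil => rfl
  | cons t c ih =>
    rw [List.foldr_cons, ih, swapStep_eq, swapPerm_cons]
    split_ifs <;> rfl

/-- Transpositions are involutions, so the inverse is their product in reverse order, which amounts
to folding from the other end. -/
theorem foldl_swapStep (c : List (ℕ × ℕ × ℕ)) (a o : ℕ) :
    c.foldl (fun o t => swapStep a t o) o = (swapPerm c a)⁻¹ o := by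
  induction c generalizing o with
  | nil => rfl
  | cons t c ih =>
    rw [List.foldl_cons, ih, swapStep_eq, swapPerm_cons]
    split_ifs
    · rw [mul_inv_rev, Equiv.swap_inv]; rfl
    · rfl

theorem actWord_eq (c : List (ℕ × ℕ × ℕ)) (w : List (ℕ × Bool)) (o : ℕ) :
    actWord c w o = lift (swapPerm c) (mk w) o := by
  induction w with
  | nil => rw [← one_eq_mk]; simp [actWord]
  | cons a w ih =>
    have e : (mk (a :: w) : FreeGroup ℕ) = mk [a] * mk w := by simp
    rw [e, _root_.map_mul, Equiv.Perm.mul_apply, ← ih]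
    change actLetter c a (actWord c w o) = _
    obtain ⟨a, _ | _⟩ := a
    · exact (foldl_swapStep c a _).trans (by simp)
    · exact (foldr_swapStep c a _).trans (by simp)

theorem primrec_swapStep :
    Primrec fun x : ℕ × (ℕ × ℕ × ℕ) × ℕ => swapStep x.1 x.2.1 x.2.2 := by
  have t : Primrec fun x : ℕ × (ℕ × ℕ × ℕ) × ℕ => x.2.1 := Primrec.fst.comp Primrec.snd
  have o : Primrec fun x : ℕ × (ℕ × ℕ × ℕ) × ℕ => x.2.2 := Primrec.snd.comp Primrec.snd
  have p := Primrec.fst.comp (Primrec.snd.comp t)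
  have q := Primrec.snd.comp (Primrec.snd.comp t)
  exact Primrec.ite (Primrec.eq.comp (Primrec.fst.comp t) Primrec.fst)
    (Primrec.ite (Primrec.eq.comp o p) q (Primrec.ite (Primrec.eq.comp o q) p o)) o

theorem primrec_actWord :
    Primrec fun x : List (ℕ × ℕ × ℕ) × List (ℕ × Bool) × ℕ => actWord x.1 x.2.1 x.2.2 := by
  have h : Primrec fun x : List (ℕ × ℕ × ℕ) × (ℕ × Bool) × ℕ => actLetter x.1 x.2.1 x.2.2 := by
    have a : Primrec fun x : List (ℕ × ℕ × ℕ) × (ℕ × Bool) × ℕ => x.2.1 :=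
      Primrec.fst.comp Primrec.snd
    have o : Primrec fun x : List (ℕ × ℕ × ℕ) × (ℕ × Bool) × ℕ => x.2.2 :=
      Primrec.snd.comp Primrec.snd
    have s₁ : Primrec₂ fun (x : List (ℕ × ℕ × ℕ) × (ℕ × Bool) × ℕ) (y : (ℕ × ℕ × ℕ) × ℕ) =>
        swapStep x.2.1.1 y.1 y.2 :=
      primrec_swapStep.comp (Primrec.pair (Primrec.fst.comp (a.comp Primrec.fst)) Primrec.snd)
    have s₂ : Primrec₂ fun (x : List (ℕ × ℕ × ℕ) × (ℕ × Bool) × ℕ) (y : ℕ × (ℕ × ℕ × ℕ)) =>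
        swapStep x.2.1.1 y.2 y.1 :=
      primrec_swapStep.comp (Primrec.pair (Primrec.fst.comp (a.comp Primrec.fst))
        (Primrec.pair (Primrec.snd.comp Primrec.snd) (Primrec.fst.comp Primrec.snd)))
    exact Primrec.ite (Primrec.eq.comp (Primrec.snd.comp a) (Primrec.const true))
      (Primrec.list_foldr Primrec.fst o s₁) (Primrec.list_foldl Primrec.fst o s₂)
  exact Primrec.list_foldr (Primrec.fst.comp Primrec.snd) (Primrec.snd.comp Primrec.snd)
    (h.comp (Primrec.pair (Primrec.fst.comp Primrec.fst) Primrec.snd)).to₂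

/-- The subgroup that a list of words generates. -/
def wordSubgroup {α : Type*} (L : List (List (α × Bool))) : Subgroup (FreeGroup α) :=
  Subgroup.closure (mk '' {v | v ∈ L})

theorem mem_wordSubgroup_iff {α : Type*} [DecidableEq α] (L : List (List (α × Bool)))
    (g : List (α × Bool)) : mk g ∈ wordSubgroup L ↔
      ∃ W : List (List (α × Bool)), (∀ w ∈ W, ∃ v ∈ L, v = w ∨ v = invRev w) ∧
        reduce W.flatten = reduce g := by
  constructor
  · intro h
    obtain ⟨W, hW, h⟩ : ∃ W : List (List (α × Bool)), (∀ w ∈ W, ∃ v ∈ L, v = w ∨ v = invRev w) ∧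
        mk W.flatten = mk g := by
      generalize (mk g : FreeGroup α) = x at h
      induction h using Subgroup.closure_induction with
      | mem x hx =>
        obtain ⟨v, hv, rfl⟩ := hx
        exact ⟨[v], by simpa using ⟨v, hv, Or.inl rfl⟩, by simp⟩
      | one => exact ⟨[], by simp, rfl⟩
      | mul x y _ _ hx hy =>
        obtain ⟨W, hW, rfl⟩ := hx
        obtain ⟨W', hW', rfl⟩ := hy
        refine ⟨W ++ W', fun w hw => ?_, by simp⟩
        rcases List.mem_append.1 hw with h | h
        exacts [hW w h, hW' w h]
      | inv x hx' hx =>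
        obtain ⟨W, hW, rfl⟩ := hx
        refine ⟨(W.map invRev).reverse, fun w hw => ?_, ?_⟩
        · obtain ⟨w', hw', rfl⟩ : ∃ w' ∈ W, invRev w' = w := by simpa using hw
          obtain ⟨v, hv, h⟩ := hW w' hw'
          exact ⟨v, hv, by rw [invRev_invRev]; exact h.symm⟩
        · rw [inv_mk]
          congr 1
          clear hW hx'
          induction W with
          | nil => rfl
          | cons w W ih => simp [ih]
    exact ⟨W, hW, reduce.sound h⟩
  · rintro ⟨W, hW, h⟩
    rw [← reduce.exact h]
    clear h
    induction W with
    | nil => exact one_mem _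
    | cons w W ih =>
      rw [List.flatten_cons, ← mul_mk]
      refine mul_mem ?_ (ih fun w' hw' => hW w' (by simp [hw']))
      obtain ⟨v, hv, rfl | rfl⟩ := hW w (by simp)
      · exact Subgroup.subset_closure ⟨_, hv, rfl⟩
      · rw [← inv_mem_iff, inv_mk]
        exact Subgroup.subset_closure ⟨_, hv, rfl⟩

/-- The separating action can be put on `ℕ` because the cosets can be numbered. Conversely, the
stabilizer of a point fixed by every word in `L` contains the subgroup they generate. -/
theorem not_mem_wordSubgroup_iff (L : List (List (ℕ × Bool))) (g : List (ℕ × Bool)) :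
    mk g ∉ wordSubgroup L ↔ ∃ c : List (ℕ × ℕ × ℕ) × ℕ,
      (∀ v ∈ L, actWord c.1 v c.2 = c.2) ∧ actWord c.1 g c.2 ≠ c.2 := by
  constructor
  · intro hg
    have : Countable (FreeGroup ℕ) := toWord_injective.countable
    have : Countable (FreeGroup ℕ ⧸ wordSubgroup L) := QuotientGroup.mk_surjective.countable
    obtain ⟨ι, hι⟩ := exists_injective_nat (FreeGroup ℕ ⧸ wordSubgroup L)
    obtain ⟨c, o, h1, h2⟩ := exists_swapPerm_separating (wordSubgroup L) L
      (fun v hv => Subgroup.subset_closure ⟨v, hv, rfl⟩) g hg ι hι.injOn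
    exact ⟨(c, o), fun v hv => (actWord_eq _ _ _).trans (h1 v hv), by
      rwa [actWord_eq]⟩
  · rintro ⟨⟨c, o⟩, h1, h2⟩ hg
    have hle : wordSubgroup L ≤
        (MulAction.stabilizer (Equiv.Perm ℕ) o).comap (lift (swapPerm c)) := by
      refine (Subgroup.closure_le _).2 ?_
      rintro _ ⟨v, hv, rfl⟩
      exact (actWord_eq _ _ _).symm.trans (h1 v hv)
    exact h2 ((actWord_eq _ _ _).trans (hle hg))

/-- Membership in finitely generated subgroups of free groups is decidable. -/
theorem computablePred_mem_wordSubgroup :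
    ComputablePred fun x : List (List (ℕ × Bool)) × List (ℕ × Bool) =>
      mk x.2 ∈ wordSubgroup x.1 := by
  refine ComputablePred.of_certificates ?_ ?_ (fun x => mem_wordSubgroup_iff x.1 x.2)
    (fun x => not_mem_wordSubgroup_iff x.1 x.2)
  · have h1 : PrimrecRel fun v w : List (ℕ × Bool) => v = w ∨ v = invRev w :=
      (Primrec.eq.comp Primrec.fst Primrec.snd).or
        (Primrec.eq.comp Primrec.fst (primrec_invRev.comp Primrec.snd))
    have h2 : PrimrecRel fun (w : List (ℕ × Bool)) (L : List (List (ℕ × Bool))) =>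
        ∃ v ∈ L, v = w ∨ v = invRev w := h1.exists_mem_list.comp Primrec.snd Primrec.fst
    exact (h2.forall_mem_list.comp Primrec.snd (Primrec.fst.comp Primrec.fst)).and
      (Primrec.eq.comp (primrec_reduce.comp (Primrec.list_flatten.comp Primrec.snd))
        (primrec_reduce.comp (Primrec.snd.comp Primrec.fst)))
  · have h1 : PrimrecRel fun (v : List (ℕ × Bool)) (c : List (ℕ × ℕ × ℕ) × ℕ) =>
        actWord c.1 v c.2 = c.2 :=
      Primrec.eq.comp (primrec_actWord.comp (Primrec.pair (Primrec.fst.comp Primrec.snd)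
        (Primrec.pair Primrec.fst (Primrec.snd.comp Primrec.snd))))
        (Primrec.snd.comp Primrec.snd)
    exact (h1.forall_mem_list.comp (Primrec.fst.comp Primrec.fst) Primrec.snd).and
      (h1.comp (Primrec.snd.comp Primrec.fst) Primrec.snd).not

/-! ### The core and the splitting of reduced words -/

/-- The prefixes of the words in `L` and of their inverses. -/
def corePrefixes {α : Type*} (L : List (List (α × Bool))) : List (List (α × Bool)) :=
  [] :: (L ++ L.map invRev).flatMap fun v => (List.range (v.length + 1)).map fun k => v.take k

theorem mem_corePrefixes {α : Type*} {L : List (List (α × Bool))} {s : List (α × Bool)} :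
    s ∈ corePrefixes L ↔ s = [] ∨ ∃ v ∈ L, s <+: v ∨ s <+: invRev v := by
  have key : ∀ v : List (α × Bool), (∃ k, k < v.length + 1 ∧ v.take k = s) ↔ s <+: v := by
    intro v
    constructor
    · rintro ⟨k, -, rfl⟩
      exact List.take_prefix _ _
    · intro h
      exact ⟨s.length, Nat.lt_succ_of_le h.length_le, (List.prefix_iff_eq_take.1 h).symm⟩
  simp only [corePrefixes, List.mem_cons, List.mem_flatMap, List.mem_append, List.mem_map,
    List.mem_range, key]
  refine or_congr_right ⟨?_, ?_⟩
  · rintro ⟨_, hv | ⟨v, hv, rfl⟩, h⟩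
    exacts [⟨_, hv, Or.inl h⟩, ⟨_, hv, Or.inr h⟩]
  · rintro ⟨v, hv, h | h⟩
    exacts [⟨v, Or.inl hv, h⟩, ⟨_, Or.inr ⟨v, hv, rfl⟩, h⟩]

theorem nil_mem_corePrefixes {α : Type*} (L : List (List (α × Bool))) :
    [] ∈ corePrefixes L := List.mem_cons_self

theorem corePrefixes_of_prefix {α : Type*} {L : List (List (α × Bool))} {s t : List (α × Bool)}
    (ht : t ∈ corePrefixes L) (h : s <+: t) : s ∈ corePrefixes L := by
  rw [mem_corePrefixes] at ht ⊢
  rcases ht with rfl | ⟨v, hv, ht | ht⟩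
  · exact Or.inl (List.prefix_nil.1 h)
  · exact Or.inr ⟨v, hv, Or.inl (h.trans ht)⟩
  · exact Or.inr ⟨v, hv, Or.inr (h.trans ht)⟩

theorem prefix_append_cases {β : Type*} {l a b : List β} (h : l <+: a ++ b) :
    l <+: a ∨ ∃ l', l = a ++ l' ∧ l' <+: b := by
  obtain ⟨r, h⟩ := h
  rcases List.append_eq_append_iff.1 h with ⟨m, rfl, -⟩ | ⟨m, rfl, rfl⟩
  · exact Or.inl (List.prefix_append _ _)
  · exact Or.inr ⟨m, rfl, List.prefix_append _ _⟩

theorem suffix_append_cases {β : Type*} {l a b : List β} (h : l <:+ a ++ b) :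
    l <:+ b ∨ ∃ l', l = l' ++ b ∧ l' <:+ a := by
  obtain ⟨r, h⟩ := h
  rcases List.append_eq_append_iff.1 h with ⟨m, rfl, rfl⟩ | ⟨m, rfl, rfl⟩
  · exact Or.inr ⟨m, rfl, List.suffix_append _ _⟩
  · exact Or.inl (List.suffix_append _ _)

theorem invRev_prefix_invRev {α : Type*} {s t : List (α × Bool)} (h : s <:+ t) :
    invRev s <+: invRev t := by
  obtain ⟨r, rfl⟩ := h
  rw [invRev_append]
  exact List.prefix_append _ _

theorem mk_mem_wordSubgroup {α : Type*} {L : List (List (α × Bool))} {v : List (α × Bool)}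
    (hv : v ∈ L) : mk v ∈ wordSubgroup L :=
  Subgroup.subset_closure ⟨v, hv, rfl⟩

/-- The elements whose cosets are vertices of the core of the coset graph. -/
def coreElements {α : Type*} (L : List (List (α × Bool))) : Set (FreeGroup α) :=
  {g | ∃ s ∈ corePrefixes L, g * (mk s)⁻¹ ∈ wordSubgroup L}

theorem mk_mem_coreElements {α : Type*} {L : List (List (α × Bool))} {s : List (α × Bool)}
    (hs : s ∈ corePrefixes L) : mk s ∈ coreElements L :=
  ⟨s, hs, by rw [mul_inv_cancel]; exact one_mem _⟩

theorem mul_mem_coreElements {α : Type*} {L : List (List (α × Bool))} {v g : FreeGroup α}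
    (hv : v ∈ wordSubgroup L) (hg : g ∈ coreElements L) : v * g ∈ coreElements L := by
  obtain ⟨s, hs, h⟩ := hg
  exact ⟨s, hs, by rw [mul_assoc]; exact mul_mem hv h⟩

theorem closure_insert_mul_mul {G : Type*} [Group G] (V : Subgroup G) {v v' : G} (hv : v ∈ V)
    (hv' : v' ∈ V) (g : G) : Subgroup.closure (insert (v * g * v') (V : Set G)) =
      Subgroup.closure (insert g (V : Set G)) := by
  have sub : ∀ h : G, (V : Set G) ⊆ Subgroup.closure (insert h (V : Set G)) := fun h =>
    (Set.subset_insert _ _).trans Subgroup.subset_closure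
  apply le_antisymm
  · refine (Subgroup.closure_le _).2 (Set.insert_subset ?_ (sub g))
    exact mul_mem (mul_mem (sub g hv) (Subgroup.subset_closure (Set.mem_insert _ _))) (sub g hv')
  · refine (Subgroup.closure_le _).2 (Set.insert_subset ?_ (sub _))
    have h := Subgroup.subset_closure (Set.mem_insert (v * g * v') (V : Set G))
    have := mul_mem (mul_mem (inv_mem (sub (v * g * v') hv)) h) (inv_mem (sub (v * g * v') hv'))
    have e : v⁻¹ * (v * g * v') * v'⁻¹ = g := by group
    rw [e] at this
    exact this

theorem wordSubgroup_cons {α : Type*} (z : List (α × Bool)) (L : List (List (α × Bool))) :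
    wordSubgroup (z :: L) =
      Subgroup.closure (insert (mk z) (wordSubgroup L : Set (FreeGroup α))) := by
  apply le_antisymm
  · refine (Subgroup.closure_le _).2 ?_
    rintro _ ⟨v, hv, rfl⟩
    refine Subgroup.subset_closure ?_
    rcases List.mem_cons.1 hv with rfl | hv
    · exact Set.mem_insert _ _
    · exact Set.mem_insert_of_mem _ (mk_mem_wordSubgroup hv)
  · refine (Subgroup.closure_le _).2 (Set.insert_subset (mk_mem_wordSubgroup (by simp)) ?_)
    refine (Subgroup.closure_le _).2 ?_
    rintro _ ⟨v, hv, rfl⟩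
    exact mk_mem_wordSubgroup (List.mem_cons_of_mem _ hv)

/-- A complete factor lies in the subgroup and can be dropped without changing the coset, so only a
prefix of one factor or of `s` remains. -/
theorem coreElements_of_prefix_flatten {α : Type*} (L : List (List (α × Bool)))
    (W : List (List (α × Bool))) (hW : ∀ w ∈ W, ∃ v ∈ L, v = w ∨ v = invRev w)
    (s : List (α × Bool)) (hs : s ∈ corePrefixes L) (l : List (α × Bool))
    (hl : l <+: W.flatten ++ s) : mk l ∈ coreElements L := by
  induction W generalizing l with
  | nil => exact mk_mem_coreElements (corePrefixes_of_prefix hs hl)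
  | cons w W ih =>
    obtain ⟨v, hv, hvw⟩ := hW w (by simp)
    rw [List.flatten_cons, List.append_assoc] at hl
    rcases prefix_append_cases hl with hl | ⟨l', rfl, hl'⟩
    · refine mk_mem_coreElements (mem_corePrefixes.2 (Or.inr ⟨v, hv, ?_⟩))
      rcases hvw with rfl | rfl
      · exact Or.inl hl
      · rw [invRev_invRev]; exact Or.inr hl
    · rw [← mul_mk]
      refine mul_mem_coreElements ?_ (ih (fun w' hw' => hW w' (by simp [hw'])) l' hl')
      rcases hvw with rfl | rfl
      · exact mk_mem_wordSubgroup hv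
      · rw [← inv_mem_iff, inv_mk]; exact mk_mem_wordSubgroup hv

/-- The word `W` splits so that the proper prefixes of the left part and the inverses of the
suffixes of the right part lie in `S`. -/
def SplitsIn {α : Type*} (S : Set (FreeGroup α)) (W : List (α × Bool)) : Prop :=
  ∃ A B, W = A ++ B ∧ (∀ l a, l ++ [a] <+: A → mk l ∈ S) ∧ ∀ r, r <:+ B → (mk r)⁻¹ ∈ S

theorem mk_append_cancel {α : Type*} (m : List (α × Bool)) (x : α) (b : Bool)
    (r : List (α × Bool)) : (mk (m ++ (x, b) :: (x, !b) :: r) : FreeGroup α) = mk (m ++ r) :=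
  Red.exact.2 ⟨m ++ r, Relation.ReflTransGen.single Red.Step.not, Relation.ReflTransGen.refl⟩

/-- When the cancelled pair lies on one side of the cut, a prefix or suffix extending past it
represents the same element as the longer one with the pair restored. -/
theorem SplitsIn.step {α : Type*} {S : Set (FreeGroup α)} {W W' : List (α × Bool)}
    (hW : SplitsIn S W) (h : Red.Step W W') : SplitsIn S W' := by
  obtain ⟨A, B, hAB, hA, hB⟩ := hW
  obtain @⟨l₁, r₁, x, b⟩ := h
  have right : ∀ m, B = m ++ (x, b) :: (x, !b) :: r₁ → ∀ r, r <:+ m ++ r₁ → (mk r)⁻¹ ∈ S := by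
    rintro m rfl r hr
    rcases suffix_append_cases hr with hr | ⟨m', rfl, hm⟩
    · exact hB r (hr.trans ((List.suffix_append [(x, b), (x, !b)] r₁).trans
        (List.suffix_append _ _)))
    · rw [← mk_append_cancel m' x b r₁]
      obtain ⟨k, rfl⟩ := hm
      exact hB _ ⟨k, by simp⟩
  rcases List.append_eq_append_iff.1 hAB with ⟨m, rfl, hm⟩ | ⟨m, rfl, hm⟩
  · have left : ∀ l a, l ++ [a] <+: l₁ → mk l ∈ S := fun l a h =>
      hA l a (h.trans (List.prefix_append _ _))
    match m, hm with
    | [], hm => exact ⟨l₁, r₁, rfl, left, right [] hm.symm⟩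
    | [c], hm =>
      -- Here the pair straddles the cut: each side loses the letter next to it.
      obtain ⟨-, rfl⟩ : (x, b) = c ∧ (x, !b) :: r₁ = B := by simpa using hm
      exact ⟨l₁, r₁, rfl, left, fun r hr => hB r (hr.trans (List.suffix_cons _ _))⟩
    | c :: d :: m', hm =>
      obtain ⟨rfl, rfl, rfl⟩ : (x, b) = c ∧ (x, !b) = d ∧ r₁ = m' ++ B := by simpa using hm
      refine ⟨l₁ ++ m', B, by simp, fun l a hl => ?_, hB⟩
      rcases prefix_append_cases hl with hl | ⟨l', hl', hm'⟩
      · exact left l a hl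
      · rcases List.eq_nil_or_concat' l' with rfl | ⟨l'', a', rfl⟩
        · exact left l a ⟨[], by simpa using hl'⟩
        · rw [← List.append_assoc] at hl'
          obtain ⟨rfl, rfl⟩ : l = l₁ ++ l'' ∧ a = a' := by
            simpa using List.append_inj' hl' rfl
          rw [← mk_append_cancel l₁ x b l'']
          obtain ⟨k, rfl⟩ := hm'
          exact hA _ a ⟨k, by simp⟩
  · exact ⟨A, m ++ r₁, by simp, hA, right m hm⟩

theorem SplitsIn.red {α : Type*} {S : Set (FreeGroup α)} {W W' : List (α × Bool)}
    (hW : SplitsIn S W) (h : Red W W') : SplitsIn S W' := by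
  induction h with
  | refl => exact hW
  | tail _ h ih => exact ih.step h

/-- If a nonempty reduced word `x` generates the free group together with the words in `L`, then it
reads in the core of the coset graph before and after one of its letters. -/
theorem exists_core_decomposition {α : Type*} (L : List (List (α × Bool)))
    (x : List (α × Bool)) (hx : IsReduced x) (hne : x ≠ [])
    (hgen : wordSubgroup (x :: L) = ⊤) :
    ∃ u a w, x = u ++ a :: w ∧ (∀ l, l <+: u → mk l ∈ coreElements L) ∧
      ∀ r, r <:+ w → (mk r)⁻¹ ∈ coreElements L := by
  classical
  set V := wordSubgroup L with hV
  rw [wordSubgroup_cons] at hgen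
  -- The connector lemma works with left cosets and `coreElements` with right cosets; inversion
  -- translates between them.
  obtain ⟨g, h, Y, hY, hxY, ⟨p, hp, hg⟩, ⟨q, hq, hh⟩⟩ := exists_short_connector V {v | v ∈ L} rfl
    {c | ∃ s ∈ corePrefixes L, c = (((mk s)⁻¹ : FreeGroup α) : FreeGroup α ⧸ V)}
    ⟨[], nil_mem_corePrefixes L, rfl⟩ (by
      intro v hv s hs
      exact ⟨invRev s, mem_corePrefixes.2 (Or.inr ⟨v, hv, Or.inr (invRev_prefix_invRev hs)⟩), by
        rw [inv_mk, invRev_invRev]⟩) (by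
      rintro _ ⟨s, hs, rfl⟩
      refine ⟨invRev s, by rw [inv_mk], fun s' hs' => ⟨invRev s', ?_, by
        rw [inv_mk, invRev_invRev]⟩⟩
      refine corePrefixes_of_prefix hs ?_
      have := invRev_prefix_invRev hs'
      rwa [invRev_invRev] at this) (mk x) hgen
  obtain ⟨W, hW, hWg⟩ := (mem_wordSubgroup_iff L (g⁻¹ * (mk p)⁻¹).toWord).1 (by
    rw [mk_toWord]
    exact QuotientGroup.eq.1 hg)
  obtain ⟨W', hW', hWh⟩ := (mem_wordSubgroup_iff L (h⁻¹ * (mk q)⁻¹).toWord).1 (by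
    rw [mk_toWord]
    exact QuotientGroup.eq.1 hh)
  have hWg' := reduce.exact hWg
  have hWh' := reduce.exact hWh
  rw [mk_toWord] at hWg' hWh'
  have hg' : g⁻¹ = mk (W.flatten ++ p) := by rw [← mul_mk, hWg', inv_mul_cancel_right]
  have hh' : h = mk (invRev (W'.flatten ++ q)) := by
    rw [← inv_mk, ← mul_mk, hWh', inv_mul_cancel_right, inv_inv]
  have hA := coreElements_of_prefix_flatten L W hW p hp
  have hB := coreElements_of_prefix_flatten L W' hW' q hq
  -- The connector goes to the left part. As it has at most one letter, no proper prefix of that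
  -- part reaches beyond `W.flatten ++ p`.
  have hsplit : SplitsIn (coreElements L) ((W.flatten ++ p ++ Y) ++ invRev (W'.flatten ++ q)) := by
    refine ⟨_, _, rfl, fun l a hl => hA l ?_, fun r hr => ?_⟩
    · have h1 := hl.length_le
      rw [List.length_append, List.length_append, List.length_singleton] at h1
      exact List.prefix_of_prefix_length_le ((List.prefix_append _ _).trans hl)
        (List.prefix_append _ _) (by omega)
    · rw [inv_mk]
      refine hB _ ?_
      have := invRev_prefix_invRev hr
      rwa [invRev_invRev] at this
  have hred : Red ((W.flatten ++ p ++ Y) ++ invRev (W'.flatten ++ q)) x := by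
    have e : mk ((W.flatten ++ p ++ Y) ++ invRev (W'.flatten ++ q)) = mk x := by
      rw [hxY, hg', hh', mul_mk, mul_mk]
    have := reduce.red (L := (W.flatten ++ p ++ Y) ++ invRev (W'.flatten ++ q))
    rwa [reduce.sound e, hx.reduce_eq] at this
  obtain ⟨A, B, rfl, h1, h2⟩ := hsplit.red hred
  -- The distinguished letter is the last one of `A`, or the first one of `B` if `A` is empty.
  rcases List.eq_nil_or_concat' A with rfl | ⟨u, a, rfl⟩
  · cases B with
    | nil => exact absurd rfl hne
    | cons a w =>
      refine ⟨[], a, w, rfl, fun l hl => ?_, fun r hr => h2 r (hr.trans (List.suffix_cons _ _))⟩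
      rw [List.prefix_nil.1 hl]
      exact mk_mem_coreElements (nil_mem_corePrefixes L)
  · refine ⟨u, a, B, by simp, fun l hl => ?_, h2⟩
    obtain ⟨k, rfl⟩ := hl
    cases k with
    | nil => exact h1 l a (by simp)
    | cons b k => exact h1 l b ⟨k ++ [a], by simp⟩

/-! ### The automaton -/

/-- The letters of the alphabet `{0, …, n} ∪ {0, …, n}⁻¹`, where `n` is the length of `L`. -/
def signedLetters (L : List (List (ℕ × Bool))) : List (ℕ × Bool) :=
  (List.range (L.length + 1)).flatMap fun i => [(i, true), (i, false)]

theorem mem_signedLetters {L : List (List (ℕ × Bool))} {a : ℕ × Bool} :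
    a ∈ signedLetters L ↔ a.1 < L.length + 1 := by
  obtain ⟨i, _ | _⟩ := a <;> simp [signedLetters]

/-- The words in `L` together with the element `g` generate all the letters. -/
def Completes (L : List (List (ℕ × Bool))) (g : FreeGroup ℕ) : Prop :=
  ∀ i < L.length + 1, of i ∈ Subgroup.closure (insert g (wordSubgroup L : Set (FreeGroup ℕ)))

/-- This invariance lets the completion test be made on the connecting transition alone, since the
rest of a path contributes only factors from the subgroup. -/
theorem completes_mul_mul {L : List (List (ℕ × Bool))} {v v' : FreeGroup ℕ}
    (hv : v ∈ wordSubgroup L) (hv' : v' ∈ wordSubgroup L) (g : FreeGroup ℕ) :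
    Completes L (v * g * v') ↔ Completes L g := by
  rw [Completes, Completes, closure_insert_mul_mul _ hv hv']

theorem completes_mul_left {L : List (List (ℕ × Bool))} {v : FreeGroup ℕ}
    (hv : v ∈ wordSubgroup L) (g : FreeGroup ℕ) : Completes L (v * g) ↔ Completes L g := by
  rw [← completes_mul_mul hv (one_mem _) g, mul_one]

theorem completes_mul_right {L : List (List (ℕ × Bool))} {v : FreeGroup ℕ}
    (hv : v ∈ wordSubgroup L) (g : FreeGroup ℕ) : Completes L (g * v) ↔ Completes L g := by
  rw [← completes_mul_mul (one_mem _) hv g, one_mul]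

/-- A state of the automaton: whether the connecting letter has been read, the current vertex of
the core, and the last letter read. -/
abbrev CoreState : Type := Bool × List (ℕ × Bool) × Option (ℕ × Bool)

/-- The transitions of the automaton. -/
def CoreStep (L : List (List (ℕ × Bool))) (t : CoreState × (ℕ × Bool) × CoreState) : Prop :=
  (t.2.2.2.2 = some t.2.1 ∧ t.1.2.2 ≠ some (t.2.1.1, !t.2.1.2)) ∧
    ((t.1.1 = t.2.2.1 ∧ mk (t.1.2.1 ++ t.2.1 :: invRev t.2.2.2.1) ∈ wordSubgroup L) ∨
      ((t.1.1 = false ∧ t.2.2.1 = true) ∧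
        Completes L (mk (t.1.2.1 ++ t.2.1 :: invRev t.2.2.2.1))))

/-- The value `none` belongs to the start, where no letter has been read that the next one could
cancel. -/
def lastLetters (L : List (List (ℕ × Bool))) : List (Option (ℕ × Bool)) :=
  none :: (signedLetters L).map some

def coreStates (L : List (List (ℕ × Bool))) : List CoreState :=
  [false, true].flatMap fun b => (corePrefixes L).flatMap fun s =>
    (lastLetters L).map fun o => (b, s, o)

def coreTriples (L : List (List (ℕ × Bool))) : List (CoreState × (ℕ × Bool) × CoreState) :=
  (coreStates L).flatMap fun p => (signedLetters L).flatMap fun a =>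
    (coreStates L).map fun q => (p, a, q)

open Classical in
/-- The automaton that recognizes the reduced words that complete `L` to a generating family. -/
noncomputable def completionAutomaton (L : List (List (ℕ × Bool))) : Automaton (ℕ × Bool) :=
  (Encodable.encode ((false, [], none) : CoreState),
    (lastLetters L).map fun o => Encodable.encode ((true, [], o) : CoreState),
    ((coreTriples L).filter fun t => decide (CoreStep L t)).map fun t =>
      (Encodable.encode t.1, t.2.1, Encodable.encode t.2.2))

/-! ### Computability of the automaton -/

theorem ComputablePred.and {α : Type*} [Primcodable α] {p q : α → Prop} (hp : ComputablePred p)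
    (hq : ComputablePred q) : ComputablePred fun a => p a ∧ q a := by
  classical
  exact ((Primrec.and.to_comp.comp hp.decide hq.decide).of_eq
    fun a => (Bool.decide_and _ _).symm).computablePred

theorem ComputablePred.or {α : Type*} [Primcodable α] {p q : α → Prop} (hp : ComputablePred p)
    (hq : ComputablePred q) : ComputablePred fun a => p a ∨ q a := by
  classical
  exact ((Primrec.or.to_comp.comp hp.decide hq.decide).of_eq
    fun a => (Bool.decide_or _ _).symm).computablePred

theorem ComputablePred.comp {α β : Type*} [Primcodable α] [Primcodable β] {p : β → Prop}
    {f : α → β} (hp : ComputablePred p) (hf : Computable f) : ComputablePred fun a => p (f a) := by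
  classical
  exact (hp.decide.comp hf).computablePred

theorem ComputablePred.forall_lt {α : Type*} [Primcodable α] {p : α → ℕ → Prop} {f : α → ℕ}
    (hp : ComputablePred fun x : α × ℕ => p x.1 x.2) (hf : Computable f) :
    ComputablePred fun a => ∀ i < f a, p a i := by
  classical
  -- The list of counterexamples below the bound is computable, and it remains to test whether it is
  -- empty.
  have h : Computable fun a => (List.range (f a)).filter fun i => decide (¬p a i) :=
    Computable.list_filter (Primrec.list_range.to_comp.comp hf) hp.not.decide
  refine (ComputablePred.comp (p := fun l : List ℕ => l = [])
    (Primrec.eq.comp Primrec.id (Primrec.const [])).computablePred h).of_eq fun a => ?_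
  simp

theorem primrec_corePrefixes :
    Primrec (corePrefixes : List (List (ℕ × Bool)) → List (List (ℕ × Bool))) := by
  refine Primrec.list_cons.comp (Primrec.const []) (Primrec.list_flatMap
    (Primrec.list_append.comp Primrec.id
      (Primrec.list_map Primrec.id (primrec_invRev.comp Primrec.snd))) ?_)
  exact Primrec.list_map (Primrec.list_range.comp
    (Primrec.succ.comp (Primrec.list_length.comp Primrec.snd)))
    (Primrec.list_take.comp Primrec.snd (Primrec.snd.comp Primrec.fst))

theorem primrec_signedLetters : Primrec signedLetters :=
  Primrec.list_flatMap (Primrec.list_range.comp (Primrec.succ.comp Primrec.list_length))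
    (Primrec.list_cons.comp (Primrec.pair Primrec.snd (Primrec.const true))
      (Primrec.list_cons.comp (Primrec.pair Primrec.snd (Primrec.const false))
        (Primrec.const [])))

theorem primrec_lastLetters : Primrec lastLetters :=
  Primrec.list_cons.comp (Primrec.const none)
    (Primrec.list_map primrec_signedLetters (Primrec.option_some.comp Primrec.snd))

theorem primrec_coreStates : Primrec coreStates := by
  refine Primrec.list_flatMap (Primrec.const [false, true]) ?_
  refine Primrec.list_flatMap (primrec_corePrefixes.comp Primrec.fst) ?_
  refine Primrec.list_map (primrec_lastLetters.comp (Primrec.fst.comp Primrec.fst)) ?_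
  exact Primrec.pair (Primrec.snd.comp (Primrec.fst.comp Primrec.fst))
    (Primrec.pair (Primrec.snd.comp Primrec.fst) Primrec.snd)

theorem primrec_coreTriples : Primrec coreTriples := by
  refine Primrec.list_flatMap primrec_coreStates ?_
  refine Primrec.list_flatMap (primrec_signedLetters.comp Primrec.fst) ?_
  refine Primrec.list_map (primrec_coreStates.comp (Primrec.fst.comp Primrec.fst)) ?_
  exact Primrec.pair (Primrec.snd.comp (Primrec.fst.comp Primrec.fst))
    (Primrec.pair (Primrec.snd.comp Primrec.fst) Primrec.snd)

theorem computablePred_completes :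
    ComputablePred fun x : List (List (ℕ × Bool)) × List (ℕ × Bool) =>
      Completes x.1 (mk x.2) := by
  refine ComputablePred.forall_lt (p := fun (x : List (List (ℕ × Bool)) × List (ℕ × Bool)) i =>
    of i ∈ Subgroup.closure (insert (mk x.2) (wordSubgroup x.1 : Set (FreeGroup ℕ)))) ?_
    (Primrec.succ.comp (Primrec.list_length.comp Primrec.fst)).to_comp
  refine (computablePred_mem_wordSubgroup.comp
    (f := fun x : (List (List (ℕ × Bool)) × List (ℕ × Bool)) × ℕ =>
      (x.1.2 :: x.1.1, [(x.2, true)])) (Primrec.to_comp (Primrec.pair (Primrec.list_cons.comp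
    (Primrec.snd.comp Primrec.fst) (Primrec.fst.comp Primrec.fst)) (Primrec.list_cons.comp
    (Primrec.pair Primrec.snd (Primrec.const true)) (Primrec.const []))))).of_eq fun x => ?_
  rw [wordSubgroup_cons]
  rfl

theorem computablePred_coreStep :
    ComputablePred fun x : List (List (ℕ × Bool)) × CoreState × (ℕ × Bool) × CoreState =>
      CoreStep x.1 x.2 := by
  have p : Primrec fun x : List (List (ℕ × Bool)) × CoreState × (ℕ × Bool) × CoreState => x.2.1 :=
    Primrec.fst.comp Primrec.snd
  have a : Primrec fun x : List (List (ℕ × Bool)) × CoreState × (ℕ × Bool) × CoreState =>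
    x.2.2.1 := Primrec.fst.comp (Primrec.snd.comp Primrec.snd)
  have q : Primrec fun x : List (List (ℕ × Bool)) × CoreState × (ℕ × Bool) × CoreState =>
    x.2.2.2 := Primrec.snd.comp (Primrec.snd.comp Primrec.snd)
  have w : Primrec fun x : List (List (ℕ × Bool)) × CoreState × (ℕ × Bool) × CoreState =>
      (x.1, x.2.1.2.1 ++ x.2.2.1 :: invRev x.2.2.2.2.1) :=
    Primrec.pair Primrec.fst (Primrec.list_append.comp (Primrec.fst.comp (Primrec.snd.comp p))
      (Primrec.list_cons.comp a (primrec_invRev.comp (Primrec.fst.comp (Primrec.snd.comp q)))))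
  have h₁ := Primrec.eq.comp (Primrec.snd.comp (Primrec.snd.comp q)) (Primrec.option_some.comp a)
  have h₂ := Primrec.eq.comp (Primrec.snd.comp (Primrec.snd.comp p)) (Primrec.option_some.comp
    (Primrec.pair (Primrec.fst.comp a) (Primrec.not.comp (Primrec.snd.comp a))))
  have h₃ := Primrec.eq.comp (Primrec.fst.comp p) (Primrec.fst.comp q)
  have h₄ := (Primrec.eq.comp (Primrec.fst.comp p) (Primrec.const false)).and
    (Primrec.eq.comp (Primrec.fst.comp q) (Primrec.const true))
  exact (h₁.and h₂.not).computablePred.and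
    ((h₃.computablePred.and (computablePred_mem_wordSubgroup.comp w.to_comp)).or
      (h₄.computablePred.and (computablePred_completes.comp w.to_comp)))

theorem computable_completionAutomaton : Computable completionAutomaton := by
  classical
  refine Computable.pair (Computable.const _) (Computable.pair ?_ ?_)
  · exact (Primrec.list_map primrec_lastLetters (Primrec.encode.comp
      (Primrec.pair (Primrec.const true) (Primrec.pair (Primrec.const [])
        Primrec.snd))).to₂).to_comp
  · have h : Computable fun L => (coreTriples L).filter fun t => decide (CoreStep L t) :=
      Computable.list_filter primrec_coreTriples.to_comp computablePred_coreStep.decide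
    refine (Primrec.to_comp (f := fun l : List (CoreState × (ℕ × Bool) × CoreState) =>
      l.map fun t => (Encodable.encode t.1, t.2.1, Encodable.encode t.2.2)) ?_).comp h
    exact Primrec.list_map Primrec.id
      (Primrec.pair (Primrec.encode.comp (Primrec.fst.comp Primrec.snd))
        (Primrec.pair (Primrec.fst.comp (Primrec.snd.comp Primrec.snd))
          (Primrec.encode.comp (Primrec.snd.comp (Primrec.snd.comp Primrec.snd)))))

/-! ### The language of the automaton -/

theorem mem_coreStates {L : List (List (ℕ × Bool))} {p : CoreState} :
    p ∈ coreStates L ↔ p.2.1 ∈ corePrefixes L ∧ p.2.2 ∈ lastLetters L := by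
  obtain ⟨_ | _, s, o⟩ := p <;> simp [coreStates]

theorem mem_completionAutomaton_transitions {L : List (List (ℕ × Bool))} {p q : CoreState}
    {a : ℕ × Bool} (hp : p ∈ coreStates L) (ha : a ∈ signedLetters L) (hq : q ∈ coreStates L)
    (h : CoreStep L (p, a, q)) :
    (Encodable.encode p, a, Encodable.encode q) ∈ (completionAutomaton L).2.2 := by
  classical
  refine List.mem_map.2 ⟨(p, a, q), List.mem_filter.2 ⟨?_, by simpa using h⟩, rfl⟩
  exact List.mem_flatMap.2 ⟨p, hp, List.mem_flatMap.2 ⟨a, ha, List.mem_map.2 ⟨q, hq, rfl⟩⟩⟩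

theorem exists_of_mem_transitions {L : List (List (ℕ × Bool))} {p : CoreState} {k : ℕ}
    {a : ℕ × Bool} (h : (Encodable.encode p, a, k) ∈ (completionAutomaton L).2.2) :
    ∃ q : CoreState, k = Encodable.encode q ∧ a ∈ signedLetters L ∧ CoreStep L (p, a, q) := by
  classical
  obtain ⟨⟨p', a', q⟩, ht, e⟩ := List.mem_map.1 h
  rw [List.mem_filter] at ht
  simp only [Prod.mk.injEq, Encodable.encode_inj] at e
  obtain ⟨rfl, rfl, rfl⟩ := e
  refine ⟨q, rfl, ?_, by simpa using ht.2⟩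
  obtain ⟨p₁, -, h⟩ := List.mem_flatMap.1 ht.1
  obtain ⟨a₁, ha, h⟩ := List.mem_flatMap.1 h
  obtain ⟨q₁, -, h⟩ := List.mem_map.1 h
  simp only [Prod.mk.injEq] at h
  exact h.2.1 ▸ ha

theorem mk_append_cons_invRev {α : Type*} (s : List (α × Bool)) (a : α × Bool)
    (t : List (α × Bool)) : (mk (s ++ a :: invRev t) : FreeGroup α) = mk s * mk [a] * (mk t)⁻¹ := by
  rw [inv_mk, mul_mk, mul_mk]
  simp

/-- What the label of a path says about its ends. -/
theorem path_completionAutomaton {L : List (List (ℕ × Bool))} {k k' : ℕ} {w : List (ℕ × Bool)}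
    (h : Automaton.Path (completionAutomaton L) k w k') (p q : CoreState)
    (hk : k = Encodable.encode p) (hk' : k' = Encodable.encode q) :
    IsReduced (p.2.2.toList ++ w) ∧ (∀ a ∈ w, a ∈ signedLetters L) ∧
      ((p.1 = q.1 ∧ mk p.2.1 * mk w * (mk q.2.1)⁻¹ ∈ wordSubgroup L) ∨
        ((p.1 = false ∧ q.1 = true) ∧ Completes L (mk p.2.1 * mk w * (mk q.2.1)⁻¹))) := by
  induction h generalizing p with
  | nil k =>
    obtain rfl : p = q := Encodable.encode_injective (hk.symm.trans hk')
    refine ⟨?_, by simp, Or.inl ⟨rfl, ?_⟩⟩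
    · cases p.2.2 <;> simp
    · rw [← one_eq_mk, mul_one, mul_inv_cancel]; exact one_mem _
  | @cons k k₁ k' a w h _ ih =>
    subst hk
    obtain ⟨q₁, rfl, ha, ⟨h₁, h₂⟩, h₃⟩ := exists_of_mem_transitions h
    obtain ⟨ih₁, ih₂, ih₃⟩ := ih q₁ rfl hk'
    simp only at h₁ h₂ h₃
    rw [mk_append_cons_invRev] at h₃
    refine ⟨?_, List.forall_mem_cons.2 ⟨ha, ih₂⟩, ?_⟩
    · rw [h₁] at ih₁
      have ih₁ : IsReduced (a :: w) := ih₁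
      cases hp : p.2.2 with
      | none => exact ih₁
      | some c =>
        refine isReduced_cons_cons.2 ⟨fun e => ?_, ih₁⟩
        by_contra hne
        refine h₂ (hp.trans ?_)
        obtain ⟨c, ε⟩ := c
        obtain ⟨a, δ⟩ := a
        simp only at e hne
        subst e
        cases ε <;> cases δ <;> simp_all
    · have e : mk p.2.1 * mk (a :: w) * (mk q.2.1)⁻¹ =
          (mk p.2.1 * mk [a] * (mk q₁.2.1)⁻¹) * (mk q₁.2.1 * mk w * (mk q.2.1)⁻¹) := by
        have : (mk (a :: w) : FreeGroup ℕ) = mk [a] * mk w := by simp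
        rw [this]; group
      rw [e]
      rcases h₃ with ⟨hp, h₃⟩ | ⟨⟨hp, hq⟩, h₃⟩ <;> rcases ih₃ with ⟨hp', ih₃⟩ | ⟨⟨hp', hq'⟩, ih₃⟩
      · exact Or.inl ⟨hp.trans hp', mul_mem h₃ ih₃⟩
      · exact Or.inr ⟨⟨hp.trans hp', hq'⟩, (completes_mul_left h₃ _).2 ih₃⟩
      · exact Or.inr ⟨⟨hp, hp'.symm.trans hq⟩, (completes_mul_right ih₃ _).2 h₃⟩
      -- A second connecting transition is impossible because the flag is already set.
      · simp [hq] at hp'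

theorem ne_inverse_of_isReduced {o : Option (ℕ × Bool)} {a : ℕ × Bool} {w : List (ℕ × Bool)}
    (h : IsReduced (o.toList ++ a :: w)) : o ≠ some (a.1, !a.2) := by
  rintro rfl
  have h : IsReduced ((a.1, !a.2) :: a :: w) := h
  have := (isReduced_cons_cons.1 h).1 rfl
  cases hb : a.2 <;> simp [hb] at this

theorem isReduced_of_append_cons {o : Option (ℕ × Bool)} {a : ℕ × Bool} {w : List (ℕ × Bool)}
    (h : IsReduced (o.toList ++ a :: w)) : IsReduced ((some a).toList ++ w) :=
  h.infix (List.suffix_append _ _).isInfix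

theorem mem_lastLetters_some {L : List (List (ℕ × Bool))} {a : ℕ × Bool}
    (ha : a ∈ signedLetters L) : some a ∈ lastLetters L :=
  List.mem_cons_of_mem _ (List.mem_map.2 ⟨a, ha, rfl⟩)

/-- A vertex of the core from which `w` leads to the base vertex. -/
theorem exists_vertex_before {L : List (List (ℕ × Bool))} {w : List (ℕ × Bool)}
    (hw : (mk w)⁻¹ ∈ coreElements L) : ∃ t ∈ corePrefixes L, mk t * mk w ∈ wordSubgroup L ∧
      (w = [] → t = []) := by
  by_cases h : w = []
  · subst h
    exact ⟨[], nil_mem_corePrefixes L, by rw [← one_eq_mk, mul_one]; exact one_mem _, fun _ => rfl⟩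
  · obtain ⟨t, ht, h'⟩ := hw
    exact ⟨t, ht, by simpa using inv_mem h', fun e => absurd e h⟩

/-- The suffixes of `w` determine the vertices to be visited. Several prefixes may name one vertex,
and only `[]` occurs in terminal states, so `hnil` makes the path end under that name. -/
theorem exists_path_after {L : List (List (ℕ × Bool))} (w s : List (ℕ × Bool))
    (o : Option (ℕ × Bool)) (hs : s ∈ corePrefixes L) (ho : o ∈ lastLetters L)
    (hred : IsReduced (o.toList ++ w)) (hlet : ∀ a ∈ w, a ∈ signedLetters L)
    (hw : ∀ r, r <:+ w → (mk r)⁻¹ ∈ coreElements L) (hsw : mk s * mk w ∈ wordSubgroup L)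
    (hnil : w = [] → s = []) :
    ∃ o' ∈ lastLetters L, Automaton.Path (completionAutomaton L)
      (Encodable.encode ((true, s, o) : CoreState)) w
      (Encodable.encode ((true, [], o') : CoreState)) := by
  induction w generalizing s o with
  | nil =>
    obtain rfl := hnil rfl
    exact ⟨o, ho, Automaton.Path.nil _⟩
  | cons a w ih =>
    have ha := hlet a (by simp)
    obtain ⟨t, ht, htw, ht'⟩ := exists_vertex_before (hw w (List.suffix_cons _ _))
    obtain ⟨o', ho', hpath⟩ := ih t (some a) ht (mem_lastLetters_some ha)
      (isReduced_of_append_cons hred) (fun b hb => hlet b (by simp [hb]))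
      (fun r hr => hw r (hr.trans (List.suffix_cons _ _))) htw ht'
    have hstep : (Encodable.encode ((true, s, o) : CoreState), a,
        Encodable.encode ((true, t, some a) : CoreState)) ∈ (completionAutomaton L).2.2 := by
      refine mem_completionAutomaton_transitions
        (mem_coreStates.2 ⟨hs, ho⟩) ha (mem_coreStates.2 ⟨ht, mem_lastLetters_some ha⟩)
        ⟨⟨rfl, ne_inverse_of_isReduced hred⟩, Or.inl ⟨rfl, ?_⟩⟩
      change mk (s ++ a :: invRev t) ∈ _
      rw [mk_append_cons_invRev]
      have : (mk (a :: w) : FreeGroup ℕ) = mk [a] * mk w := by simp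
      rw [this] at hsw
      have := mul_mem hsw (inv_mem htw)
      convert this using 1
      group
    exact ⟨o', ho', Automaton.Path.cons hstep hpath⟩

theorem exists_path_through {L : List (List (ℕ × Bool))} (u : List (ℕ × Bool)) (a : ℕ × Bool)
    (w s : List (ℕ × Bool)) (o : Option (ℕ × Bool)) (hs : s ∈ corePrefixes L)
    (ho : o ∈ lastLetters L) (hred : IsReduced (o.toList ++ (u ++ a :: w)))
    (hlet : ∀ b ∈ u ++ a :: w, b ∈ signedLetters L)
    (hu : ∀ l, l <+: u → mk s * mk l ∈ coreElements L)
    (hw : ∀ r, r <:+ w → (mk r)⁻¹ ∈ coreElements L)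
    (hgen : Completes L (mk s * mk (u ++ a :: w))) :
    ∃ o' ∈ lastLetters L, Automaton.Path (completionAutomaton L)
      (Encodable.encode ((false, s, o) : CoreState)) (u ++ a :: w)
      (Encodable.encode ((true, [], o') : CoreState)) := by
  induction u generalizing s o with
  | nil =>
    have ha := hlet a (by simp)
    obtain ⟨t, ht, htw, ht'⟩ := exists_vertex_before (hw w List.suffix_rfl)
    obtain ⟨o', ho', hpath⟩ := exists_path_after w t (some a) ht (mem_lastLetters_some ha)
      (isReduced_of_append_cons hred) (fun b hb => hlet b (by simp [hb])) hw htw ht'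
    have hstep : (Encodable.encode ((false, s, o) : CoreState), a,
        Encodable.encode ((true, t, some a) : CoreState)) ∈ (completionAutomaton L).2.2 := by
      refine mem_completionAutomaton_transitions
        (mem_coreStates.2 ⟨hs, ho⟩) ha (mem_coreStates.2 ⟨ht, mem_lastLetters_some ha⟩)
        ⟨⟨rfl, ne_inverse_of_isReduced hred⟩, Or.inr ⟨⟨rfl, rfl⟩, ?_⟩⟩
      change Completes L (mk (s ++ a :: invRev t))
      -- Since `mk t * mk w` lies in the subgroup, testing with `(mk t)⁻¹` amounts to testing with
      -- the remaining word `w`.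
      rw [mk_append_cons_invRev, ← completes_mul_right htw]
      have e : (mk ([] ++ a :: w) : FreeGroup ℕ) = mk [a] * mk w := by simp
      rw [e] at hgen
      convert hgen using 1
      group
    exact ⟨o', ho', Automaton.Path.cons hstep hpath⟩
  | cons b u ih =>
    have hb := hlet b (by simp)
    obtain ⟨t, ht, hst⟩ := hu [b] ⟨u, rfl⟩
    have e : ∀ r : List (ℕ × Bool), (mk (b :: r) : FreeGroup ℕ) = mk [b] * mk r :=
      fun r => by simp
    -- Passing to the name `t` of the next vertex multiplies on the left by an element of the
    -- subgroup, which preserves both core membership and completion.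
    have e' : ∀ r : List (ℕ × Bool), mk t * mk r =
        (mk s * mk [b] * (mk t)⁻¹)⁻¹ * (mk s * mk (b :: r)) := by
      intro r; rw [e r]; group
    obtain ⟨o', ho', hpath⟩ := ih t (some b) ht (mem_lastLetters_some hb)
      (isReduced_of_append_cons hred) (fun c hc => hlet c (by simpa using Or.inr (by simpa using hc)))
      (fun l hl => by
        rw [e' l]
        exact mul_mem_coreElements (inv_mem hst) (hu _ (List.cons_prefix_cons.2 ⟨rfl, hl⟩)))
      (by rw [e', completes_mul_left (inv_mem hst)]; exact hgen)
    have hstep : (Encodable.encode ((false, s, o) : CoreState), b,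
        Encodable.encode ((false, t, some b) : CoreState)) ∈ (completionAutomaton L).2.2 := by
      refine mem_completionAutomaton_transitions
        (mem_coreStates.2 ⟨hs, ho⟩) hb (mem_coreStates.2 ⟨ht, mem_lastLetters_some hb⟩)
        ⟨⟨rfl, ne_inverse_of_isReduced hred⟩, Or.inl ⟨rfl, ?_⟩⟩
      change mk (s ++ b :: invRev t) ∈ _
      rwa [mk_append_cons_invRev]
    exact ⟨o', ho', Automaton.Path.cons hstep hpath⟩

theorem isReduced_and_completes_of_mem_language {L : List (List (ℕ × Bool))} {x : List (ℕ × Bool)}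
    (h : x ∈ Automaton.language (completionAutomaton L)) :
    IsReduced x ∧ (∀ a ∈ x, a ∈ signedLetters L) ∧ Completes L (mk x) := by
  obtain ⟨t, ht, hpath⟩ := h
  obtain ⟨o, -, rfl⟩ := List.mem_map.1 ht
  obtain ⟨h₁, h₂, h₃⟩ := path_completionAutomaton hpath (false, [], none) (true, [], o) rfl rfl
  refine ⟨h₁, h₂, ?_⟩
  rcases h₃ with ⟨h, -⟩ | ⟨-, h₃⟩
  · cases h
  · rw [← one_eq_mk, one_mul, inv_one, mul_one] at h₃
    exact h₃

theorem mem_language_of_decomposition {L : List (List (ℕ × Bool))} {u : List (ℕ × Bool)}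
    {a : ℕ × Bool} {w : List (ℕ × Bool)} (hred : IsReduced (u ++ a :: w))
    (hlet : ∀ b ∈ u ++ a :: w, b ∈ signedLetters L)
    (hu : ∀ l, l <+: u → mk l ∈ coreElements L)
    (hw : ∀ r, r <:+ w → (mk r)⁻¹ ∈ coreElements L) (hgen : Completes L (mk (u ++ a :: w))) :
    u ++ a :: w ∈ Automaton.language (completionAutomaton L) := by
  obtain ⟨o, ho, hpath⟩ := exists_path_through u a w [] none (nil_mem_corePrefixes L)
    List.mem_cons_self hred hlet (fun l hl => by rw [← one_eq_mk, one_mul]; exact hu l hl) hw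
    (by rw [← one_eq_mk, one_mul]; exact hgen)
  exact ⟨_, List.mem_map.2 ⟨o, ho, rfl⟩, hpath⟩

end

/-! ### Kleene's theorem -/

theorem Automaton.Path.append {β : Type*} {M : Automaton β} {p q r : ℕ} {w w' : List β}
    (h : Automaton.Path M p w q) (h' : Automaton.Path M q w' r) :
    Automaton.Path M p (w ++ w') r := by
  induction h with
  | nil => exact h'
  | cons he _ ih => exact Automaton.Path.cons he (ih h')

theorem Automaton.Path.mono {β : Type*} {M N : Automaton β} (hMN : M.2.2 ⊆ N.2.2) {p q : ℕ}
    {w : List β} (h : Automaton.Path M p w q) : Automaton.Path N p w q := by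
  induction h with
  | nil => exact Automaton.Path.nil _
  | cons he _ ih => exact Automaton.Path.cons (hMN he) ih

/-- The labels of the paths from `p` to `q` with transitions in `E`. -/
def pathLabels {β : Type*} (E : List (ℕ × β × ℕ)) (p q : ℕ) : Set (FreeMonoid β) :=
  {w | Automaton.Path ((0, [], E) : Automaton β) p w.toList q}

theorem one_mem_pathLabels {β : Type*} (E : List (ℕ × β × ℕ)) (p : ℕ) :
    (1 : FreeMonoid β) ∈ pathLabels E p p := Automaton.Path.nil p

theorem mul_mem_pathLabels {β : Type*} {E : List (ℕ × β × ℕ)} {p q r : ℕ} {w w' : FreeMonoid β}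
    (h : w ∈ pathLabels E p q) (h' : w' ∈ pathLabels E q r) : w * w' ∈ pathLabels E p r :=
  Automaton.Path.append h h'

theorem pathLabels_subset_cons {β : Type*} (e : ℕ × β × ℕ) (E : List (ℕ × β × ℕ)) (p q : ℕ) :
    pathLabels E p q ⊆ pathLabels (e :: E) p q :=
  fun _ h => Automaton.Path.mono (List.subset_cons_self _ _) h

theorem of_mem_pathLabels {β : Type*} {E : List (ℕ × β × ℕ)} {p q : ℕ} {a : β}
    (h : (p, a, q) ∈ E) : FreeMonoid.of a ∈ pathLabels E p q :=
  Automaton.Path.cons h (Automaton.Path.nil q)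

/-- A path is cut at each use of the new transition. Between two consecutive uses it leads from `s`
back to `r` through the old transitions, which gives the star. -/
theorem pathLabels_cons {β : Type*} (r s : ℕ) (a : β) (E : List (ℕ × β × ℕ)) (p q : ℕ) :
    pathLabels ((r, a, s) :: E) p q = pathLabels E p q ∪
      pathLabels E p r * {FreeMonoid.of a} *
        (⋃ n : ℕ, (pathLabels E s r * {FreeMonoid.of a}) ^ n) * pathLabels E s q := by
  set K := pathLabels E s r * {FreeMonoid.of a} with hK
  have hsub := fun p q => pathLabels_subset_cons (r, a, s) E p q
  have ha : FreeMonoid.of a ∈ pathLabels ((r, a, s) :: E) r s :=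
    of_mem_pathLabels List.mem_cons_self
  apply Set.Subset.antisymm
  · intro w hw
    have key : ∀ (M : Automaton β) (p q : ℕ) (w : List β), Automaton.Path M p w q →
        M.2.2 = (r, a, s) :: E → FreeMonoid.ofList w ∈ pathLabels E p q ∪
          pathLabels E p r * {FreeMonoid.of a} * (⋃ n : ℕ, K ^ n) * pathLabels E s q := by
      intro M p q w h hM
      induction h with
      | nil p => exact Or.inl (one_mem_pathLabels E p)
      | @cons p₁ p₂ p₃ b w he _ ih =>
        rw [FreeMonoid.ofList_cons]
        rw [hM] at he
        rcases List.mem_cons.1 he with he | he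
        · obtain ⟨rfl, rfl, rfl⟩ : p₁ = r ∧ b = a ∧ p₂ = s := by simpa using he
          refine Or.inr ?_
          rcases ih with ih | ih
          · refine Set.mul_mem_mul (a := FreeMonoid.of b) ?_ ih
            exact ⟨FreeMonoid.of b, ⟨1, one_mem_pathLabels E _, _, rfl, one_mul _⟩, 1,
              Set.mem_iUnion.2 ⟨0, by simp⟩, mul_one _⟩
          · obtain ⟨_, ⟨x, hx, y, hy, rfl⟩, z, hz, hw⟩ := ih
            obtain ⟨n, hn⟩ := Set.mem_iUnion.1 hy
            refine ⟨_, ⟨FreeMonoid.of b, ⟨1, one_mem_pathLabels E _, _, rfl, one_mul _⟩, x * y,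
              Set.mem_iUnion.2 ⟨n + 1, ?_⟩, rfl⟩, z, hz, ?_⟩
            · rw [pow_succ']; exact Set.mul_mem_mul hx hn
            · simp only [mul_assoc] at hw ⊢
              rw [hw]
        · have hb := of_mem_pathLabels he
          rcases ih with ih | ih
          · exact Or.inl (mul_mem_pathLabels hb ih)
          · refine Or.inr ?_
            obtain ⟨_, ⟨_, ⟨x, hx, _, rfl, rfl⟩, y, hy, rfl⟩, z, hz, hw⟩ := ih
            refine ⟨_, ⟨_, ⟨_, mul_mem_pathLabels hb hx, _, rfl, rfl⟩, y, hy, rfl⟩, z, hz, ?_⟩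
            simp only [mul_assoc] at hw ⊢
            rw [hw]
    exact key _ _ _ _ hw rfl
  · rintro w (hw | ⟨_, ⟨_, ⟨x, hx, _, rfl, rfl⟩, y, hy, rfl⟩, z, hz, rfl⟩)
    · exact hsub _ _ hw
    · obtain ⟨n, hn⟩ := Set.mem_iUnion.1 hy
      have hy : y ∈ pathLabels ((r, a, s) :: E) s s := by
        clear hy
        induction n generalizing y with
        | zero =>
          obtain rfl : y = 1 := by simpa using hn
          exact one_mem_pathLabels _ _
        | succ n ih =>
          rw [pow_succ] at hn
          obtain ⟨y', hy', _, ⟨x', hx', _, rfl, rfl⟩, rfl⟩ := hn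
          exact mul_mem_pathLabels (ih y' hy') (mul_mem_pathLabels (hsub _ _ hx') ha)
      exact mul_mem_pathLabels (mul_mem_pathLabels (mul_mem_pathLabels (hsub _ _ hx) ha) hy)
        (hsub _ _ hz)

theorem isRational_pathLabels {β : Type u} (E : List (ℕ × β × ℕ)) (p q : ℕ) :
    IsRational (pathLabels E p q) := by
  induction E generalizing p q with
  | nil =>
    refine IsRational.finite ((Set.finite_singleton 1).subset ?_)
    intro w hw
    have hw : Automaton.Path ((0, [], []) : Automaton β) p w.toList q := hw
    generalize hl : w.toList = l at hw
    cases hw with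
    | nil => exact hl
    | cons he => simp at he
  | cons e E ih =>
    obtain ⟨r, a, s⟩ := e
    rw [pathLabels_cons]
    have hf : IsRational ({FreeMonoid.of a} : Set (FreeMonoid β)) :=
      IsRational.finite (Set.finite_singleton _)
    exact (ih p q).union ((((ih p r).mul hf).mul ((ih s r).mul hf).star).mul (ih s q))

/-- **Kleene's theorem**: the language of a finite automaton is rational. -/
theorem isRational_language {β : Type u} (M : Automaton β) :
    IsRational (M := FreeMonoid β) (FreeMonoid.toList ⁻¹' Automaton.language M) := by
  obtain ⟨p, T, E⟩ := M
  have h : ∀ T : List ℕ, IsRational (M := FreeMonoid β)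
      (FreeMonoid.toList ⁻¹' Automaton.language ((p, T, E) : Automaton β)) := by
    intro T
    induction T with
    | nil =>
      refine IsRational.finite (Set.finite_empty.subset ?_)
      rintro w ⟨t, ht, -⟩
      simp at ht
    | cons t T ih =>
      have e : FreeMonoid.toList ⁻¹' Automaton.language ((p, t :: T, E) : Automaton β) =
          pathLabels E p t ∪ FreeMonoid.toList ⁻¹' Automaton.language ((p, T, E) : Automaton β) := by
        have hm : ∀ T' : List ℕ, ∀ w t', Automaton.Path ((p, T', E) : Automaton β) p w t' ↔
            Automaton.Path ((0, [], E) : Automaton β) p w t' := fun T' w t' =>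
          ⟨fun h => h.mono (List.Subset.refl E), fun h => h.mono (List.Subset.refl E)⟩
        ext w
        simp [Automaton.language, pathLabels, hm]
      rw [e]
      exact (isRational_pathLabels E p t).union ih
  exact h T

/-- The language of words over `γ` that a finite automaton over a larger alphabet recognizes is
rational. -/
theorem isRational_preimage_language {β : Type*} {γ : Type u} [Finite γ] (M : Automaton β)
    (c : γ → β) :
    IsRational (M := FreeMonoid γ) {w | w.toList.map c ∈ Automaton.language M} := by
  classical
  have := Fintype.ofFinite γ
  -- Each transition is copied once for every letter of `γ` that `c` sends to its label.
  let N : Automaton γ := (M.1, M.2.1, M.2.2.flatMap fun e =>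
    ((Finset.univ : Finset γ).toList.filter fun a => c a = e.2.1).map fun a => (e.1, a, e.2.2))
  have hN : ∀ p a q, (p, a, q) ∈ N.2.2 ↔ (p, c a, q) ∈ M.2.2 := by
    intro p a q
    simp only [N, List.mem_flatMap, List.mem_map, List.mem_filter, Prod.exists]
    constructor
    · rintro ⟨p', b, q', h, a', ha', e⟩
      obtain ⟨rfl, rfl, rfl⟩ : p' = p ∧ a' = a ∧ q' = q := by simpa using e
      obtain rfl : c a' = b := by simpa using ha'
      exact h
    · intro h
      exact ⟨p, c a, q, h, a, by simp, rfl⟩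
  have hpath : ∀ (w : List γ) p q, Automaton.Path N p w q ↔ Automaton.Path M p (w.map c) q := by
    intro w
    induction w with
    | nil =>
      intro p q
      constructor
      · intro h; cases h; exact Automaton.Path.nil _
      · intro h; cases h; exact Automaton.Path.nil _
    | cons a w ih =>
      intro p q
      constructor
      · intro h
        cases h with
        | cons he h => exact Automaton.Path.cons ((hN _ _ _).1 he) ((ih _ _).1 h)
      · intro h
        cases h with
        | cons he h => exact Automaton.Path.cons ((hN _ _ _).2 he) ((ih _ _).2 h)
  convert isRational_language N using 1
  ext w
  simp [Automaton.language, hpath, N]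

/-! ### The double coset of a completing element -/

section
open FreeGroup

/-- The exponent sum of `t` vanishes on the other generators but not on `t`. -/
theorem of_notMem_closure_of_ne {ι : Type*} (t : ι) :
    of t ∉ Subgroup.closure (of '' {i : ι | i ≠ t}) := by
  classical
  intro h
  have hle : Subgroup.closure (of '' {i : ι | i ≠ t}) ≤
      (lift fun i => if i = t then Multiplicative.ofAdd (1 : ℤ) else 1).ker := by
    refine (Subgroup.closure_le _).2 ?_
    rintro _ ⟨i, hi, rfl⟩
    have hi : i ≠ t := hi
    simp [MonoidHom.mem_ker, hi]
  have := hle h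
  rw [MonoidHom.mem_ker, lift_apply_of, if_pos rfl] at this
  exact absurd (congrArg Multiplicative.toAdd this) (by simp)

/-- An element that generates the free group together with all free generators but `t` is `t` or
`t⁻¹` up to multiplication by elements of the subgroup of these generators. -/
theorem mem_double_coset_of_closure_eq_top {ι : Type*} (t : ι) (x : FreeGroup ι)
    (hx : Subgroup.closure (insert x
      (Subgroup.closure (of '' {i : ι | i ≠ t}) : Set (FreeGroup ι))) = ⊤) :
    ∃ v ∈ Subgroup.closure (of '' {i : ι | i ≠ t}), ∃ y, (y = of t ∨ y = (of t)⁻¹) ∧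
      ∃ v' ∈ Subgroup.closure (of '' {i : ι | i ≠ t}), x = v * y * v' := by
  set V := Subgroup.closure (of '' {i : ι | i ≠ t}) with hV
  have hof : ∀ i, i ≠ t → of i ∈ V := fun i hi => Subgroup.subset_closure ⟨i, hi, rfl⟩
  have hone : ∀ g : FreeGroup ι, (g : FreeGroup ι ⧸ V) = ((1 : FreeGroup ι) : FreeGroup ι ⧸ V) ↔
      g ∈ V := fun g => by rw [QuotientGroup.eq, mul_one, inv_mem_iff]
  -- Each generator of `V` is a single letter and gives a loop at the base vertex, so that vertex
  -- alone serves as the core.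
  obtain ⟨g, h, Y, hY, hxY, hg, hh⟩ := exists_short_connector V
    ((fun i => [(i, true)]) '' {i : ι | i ≠ t}) (by rw [hV, Set.image_image]; rfl)
    {((1 : FreeGroup ι) : FreeGroup ι ⧸ V)} rfl (by
      rintro _ ⟨i, hi, rfl⟩ s hs
      rw [Set.mem_singleton_iff, hone]
      rcases List.suffix_cons_iff.1 hs with rfl | hs
      · exact hof i hi
      · rw [List.suffix_nil.1 hs]; exact one_mem V) (by
      rintro c rfl
      refine ⟨[], rfl, fun s hs => ?_⟩
      rw [List.suffix_nil.1 hs]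
      rfl) x hx
  rw [Set.mem_singleton_iff, hone] at hg hh
  have hYV : mk Y ∉ V := by
    intro h'
    have hxV : x ∈ V := by rw [hxY]; exact mul_mem (mul_mem (inv_mem hg) h') hh
    rw [Set.insert_eq_of_mem hxV, Subgroup.closure_eq] at hx
    exact of_notMem_closure_of_ne t (hV ▸ hx ▸ Subgroup.mem_top _)
  refine ⟨g⁻¹, inv_mem hg, mk Y, ?_, h, hh, hxY⟩
  match Y, hY with
  | [], _ => exact absurd (one_mem V) hYV
  | [(i, b)], _ =>
    obtain rfl : i = t := by
      by_contra hi
      refine hYV ?_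
      cases b
      · exact inv_mem (hof i hi)
      · exact hof i hi
    cases b
    · exact Or.inr rfl
    · exact Or.inl rfl

theorem closure_insert_inv {G : Type*} [Group G] (V : Subgroup G) (g : G) :
    Subgroup.closure (insert g⁻¹ (V : Set G)) = Subgroup.closure (insert g (V : Set G)) := by
  have key : ∀ g : G, Subgroup.closure (insert g⁻¹ (V : Set G)) ≤
      Subgroup.closure (insert g (V : Set G)) := fun g =>
    (Subgroup.closure_le _).2 (Set.insert_subset
      (inv_mem (Subgroup.subset_closure (Set.mem_insert _ _)))
      ((Set.subset_insert _ _).trans Subgroup.subset_closure))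
  refine le_antisymm (key g) ?_
  simpa using key g⁻¹

theorem wordSubgroup_ofFn {α : Type*} {n : ℕ} (v : Fin n → List (α × Bool)) :
    wordSubgroup (List.ofFn v) = Subgroup.closure (Set.range fun i => mk (v i)) := by
  rw [wordSubgroup]
  congr 1
  ext g
  simp [List.mem_ofFn]

theorem mem_basisCompletions_iff {α : Type*} {n : ℕ} (e : α ≃ Fin (n + 1))
    (v : Fin n → List (α × Bool)) (x : List (α × Bool)) :
    x ∈ basisCompletions v ↔ FreeGroup.IsReduced x ∧ Subgroup.closure (insert (mk x)
      (wordSubgroup (List.ofFn v) : Set (FreeGroup α))) = ⊤ := by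
  have := Finite.of_equiv _ e.symm
  rw [basisCompletions, Set.mem_ofPred_eq, isFreeBasis_iff_closure_eq_top e,
    ← wordSubgroup_cons, wordSubgroup]
  have : Set.range (Fin.snoc (fun i => mk (v i)) (mk x) : Fin (n + 1) → FreeGroup α) =
      mk '' {w | w ∈ x :: List.ofFn v} := by
    ext g
    simp only [Set.mem_range, Fin.exists_fin_succ', Fin.snoc_castSucc, Fin.snoc_last, Set.mem_image,
      Set.mem_ofPred_eq, List.mem_cons, List.mem_ofFn]
    constructor
    · rintro (⟨i, rfl⟩ | rfl)
      exacts [⟨_, Or.inr ⟨i, rfl⟩, rfl⟩, ⟨_, Or.inl rfl, rfl⟩]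
    · rintro ⟨_, rfl | ⟨i, rfl⟩, rfl⟩
      exacts [Or.inr rfl, Or.inl ⟨i, rfl⟩]
  rw [this]

theorem ne_nil_of_mem_basisCompletions {α : Type*} {n : ℕ} {v : Fin n → List (α × Bool)}
    {x : List (α × Bool)} (hx : x ∈ basisCompletions v) : x ≠ [] := by
  rintro rfl
  -- The trivial element cannot belong to a basis.
  refine of_ne_one (Fin.last n) (hx.2.1 ?_)
  rw [_root_.map_one, lift_apply_of, Fin.snoc_last]
  rfl

theorem basisCompletions_eq {α : Type*} {n : ℕ} (e : α ≃ Fin (n + 1))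
    (v : Fin n → List (α × Bool)) (z : List (α × Bool)) (hz : z ∈ basisCompletions v) :
    basisCompletions v = {x | FreeGroup.IsReduced x ∧ mk x ∈
      (wordSubgroup (List.ofFn v) : Set (FreeGroup α)) * {mk z, (mk z)⁻¹} *
        (wordSubgroup (List.ofFn v) : Set (FreeGroup α))} := by
  ext x
  rw [mem_basisCompletions_iff e, Set.mem_ofPred_eq]
  refine and_congr_right fun _ => ?_
  set V := wordSubgroup (List.ofFn v) with hV
  constructor
  · intro hx
    -- This isomorphism carries the standard basis to `(v, z)`, hence the subgroup of all generators
    -- but the last to `V`.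
    let Φ := MulEquiv.ofBijective _ hz.2
    set V' := Subgroup.closure (of '' {i : Fin (n + 1) | i ≠ Fin.last n}) with hV'
    have hΦ : ∀ i, Φ (of i) =
      (Fin.snoc (fun i => mk (v i)) (mk z) : Fin (n + 1) → FreeGroup α) i := fun _ =>
      lift_apply_of
    have hmap : V'.map Φ.toMonoidHom = V := by
      rw [hV', MonoidHom.map_closure, hV, wordSubgroup_ofFn, Set.image_image]
      congr 1
      ext g
      constructor
      · rintro ⟨i, hi, rfl⟩
        obtain ⟨j, rfl⟩ := Fin.exists_castSucc_eq.2 hi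
        exact ⟨j, by simpa using (hΦ j.castSucc).symm⟩
      · rintro ⟨j, rfl⟩
        exact ⟨j.castSucc, (Fin.castSucc_lt_last j).ne, by simpa using hΦ j.castSucc⟩
    obtain ⟨x', hx'⟩ := Φ.surjective (mk x)
    have hx'' : Subgroup.closure (insert x' (V' : Set (FreeGroup (Fin (n + 1))))) = ⊤ := by
      apply Subgroup.map_injective (f := Φ.toMonoidHom) Φ.injective
      rw [MonoidHom.map_closure, Set.image_insert_eq, ← Subgroup.coe_map, hmap,
        Subgroup.map_top_of_surjective Φ.toMonoidHom Φ.surjective, ← hx, ← hx']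
      rfl
    obtain ⟨a, ha, y, hy, b, hb, rfl⟩ := mem_double_coset_of_closure_eq_top _ _ hx''
    rw [_root_.map_mul, _root_.map_mul] at hx'
    rw [← hx', ← hmap]
    refine Set.mul_mem_mul (Set.mul_mem_mul ⟨a, ha, rfl⟩ ?_) ⟨b, hb, rfl⟩
    have hl : Φ (of (Fin.last n)) = mk z := by rw [hΦ, Fin.snoc_last]
    rcases hy with rfl | rfl
    · exact Or.inl hl
    · exact Or.inr (by rw [Set.mem_singleton_iff, _root_.map_inv, hl])
  · rintro ⟨_, ⟨a, ha, y, hy, rfl⟩, b, hb, hx⟩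
    have hz' := ((mem_basisCompletions_iff e v z).1 hz).2
    simp only at hx
    rw [← hx, closure_insert_mul_mul V ha hb]
    rcases hy with rfl | rfl
    · exact hz'
    · rwa [closure_insert_inv]

/-! ### Transfer between the alphabet and its enumeration -/

variable {α : Type*} {n : ℕ} (e : α ≃ Fin (n + 1))

theorem map_mk_eq_mk_codeWord (w : List (α × Bool)) :
    FreeGroup.map (fun a => (e a : ℕ)) (mk w) = mk (codeWord e w) := rfl

theorem map_code_injective : Function.Injective (FreeGroup.map fun a => (e a : ℕ)) :=
  FreeGroup.map_injective (Fin.val_injective.comp e.injective)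

theorem wordSubgroup_map_codeWord (L : List (List (α × Bool))) :
    wordSubgroup (L.map (codeWord e)) =
      (wordSubgroup L).map (FreeGroup.map fun a => (e a : ℕ)) := by
  rw [wordSubgroup, wordSubgroup, MonoidHom.map_closure, Set.image_image]
  congr 1
  ext g
  simp [codeWord]

theorem invRev_codeWord (w : List (α × Bool)) :
    invRev (codeWord e w) = codeWord e (invRev w) := by
  simp [invRev, codeWord, Function.comp_def]

theorem codeWord_mem_corePrefixes {L : List (List (α × Bool))} {s : List (α × Bool)}
    (hs : s ∈ corePrefixes L) : codeWord e s ∈ corePrefixes (L.map (codeWord e)) := by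
  rw [mem_corePrefixes] at hs ⊢
  rcases hs with rfl | ⟨v, hv, h⟩
  · exact Or.inl rfl
  · refine Or.inr ⟨_, List.mem_map_of_mem hv, ?_⟩
    rw [invRev_codeWord]
    exact h.imp (fun h => h.map _) fun h => h.map _

theorem map_mem_coreElements {L : List (List (α × Bool))} {g : FreeGroup α}
    (hg : g ∈ coreElements L) :
    FreeGroup.map (fun a => (e a : ℕ)) g ∈ coreElements (L.map (codeWord e)) := by
  obtain ⟨s, hs, h⟩ := hg
  refine ⟨_, codeWord_mem_corePrefixes e hs, ?_⟩
  rw [wordSubgroup_map_codeWord, ← map_mk_eq_mk_codeWord, ← _root_.map_inv, ← _root_.map_mul]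
  exact Subgroup.mem_map_of_mem _ h

/-- The enumeration embeds the free group on `α` onto the subgroup generated by the letters below `n
+ 1`. The condition on the length of `L` makes these exactly the letters that `Completes` asks for.
-/
theorem completes_map_iff {L : List (List (α × Bool))} (hL : L.length = n) (g : FreeGroup α) :
    Completes (L.map (codeWord e)) (FreeGroup.map (fun a => (e a : ℕ)) g) ↔
      Subgroup.closure (insert g (wordSubgroup L : Set (FreeGroup α))) = ⊤ := by
  have h : Subgroup.closure (insert (FreeGroup.map (fun a => (e a : ℕ)) g)
      (wordSubgroup (L.map (codeWord e)) : Set (FreeGroup ℕ))) =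
      (Subgroup.closure (insert g (wordSubgroup L : Set (FreeGroup α)))).map
        (FreeGroup.map fun a => (e a : ℕ)) := by
    rw [MonoidHom.map_closure, Set.image_insert_eq, wordSubgroup_map_codeWord, Subgroup.coe_map]
  rw [Completes, h, List.length_map, hL]
  constructor
  · intro h
    rw [eq_top_iff, ← closure_range_of, Subgroup.closure_le]
    rintro _ ⟨a, rfl⟩
    have := h (e a) (e a).2
    rw [← map.of (f := fun a => (e a : ℕ)) (x := a)] at this
    exact (Subgroup.mem_map_iff_mem (map_code_injective e)).1 this
  · intro h i hi
    rw [h]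
    exact ⟨of (e.symm ⟨i, hi⟩), Subgroup.mem_top _, by simp⟩

theorem isReduced_codeWord_iff (x : List (α × Bool)) :
    FreeGroup.IsReduced (codeWord e x) ↔ FreeGroup.IsReduced x := by
  simp [FreeGroup.IsReduced, codeWord, List.isChain_map, Fin.val_inj]

theorem exists_codeWord_eq (x : List (ℕ × Bool)) (hx : ∀ a ∈ x, a.1 < n + 1) :
    ∃ w, codeWord e w = x := by
  induction x with
  | nil => exact ⟨[], rfl⟩
  | cons a x ih =>
    obtain ⟨w, rfl⟩ := ih fun b hb => hx b (List.mem_cons_of_mem _ hb)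
    exact ⟨(e.symm ⟨a.1, hx a List.mem_cons_self⟩, a.2) :: w, by simp [codeWord]⟩

theorem language_completionAutomaton (v : Fin n → List (α × Bool)) :
    Automaton.language (completionAutomaton (List.ofFn fun i => codeWord e (v i))) =
      codeWord e '' basisCompletions v := by
  have hL : (List.ofFn fun i => codeWord e (v i)) = (List.ofFn v).map (codeWord e) := by
    rw [List.map_ofFn]; rfl
  have hlen : (List.ofFn v).length = n := List.length_ofFn
  rw [hL]
  ext x
  constructor
  · intro hx
    obtain ⟨h₁, h₂, h₃⟩ := isReduced_and_completes_of_mem_language hx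
    obtain ⟨w, rfl⟩ := exists_codeWord_eq e x fun a ha => by
      have := mem_signedLetters.1 (h₂ a ha)
      rwa [List.length_map, hlen] at this
    rw [← map_mk_eq_mk_codeWord, completes_map_iff e hlen] at h₃
    exact ⟨w, (mem_basisCompletions_iff e v w).2 ⟨(isReduced_codeWord_iff e w).1 h₁, h₃⟩, rfl⟩
  · rintro ⟨w, hw, rfl⟩
    have hne := ne_nil_of_mem_basisCompletions hw
    obtain ⟨h₁, h₂⟩ := (mem_basisCompletions_iff e v w).1 hw
    obtain ⟨l, a, r, rfl, hl, hr⟩ := exists_core_decomposition (List.ofFn v) w h₁ hne (by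
      rwa [wordSubgroup_cons])
    have hred := (isReduced_codeWord_iff e _).2 h₁
    have hgen := (completes_map_iff e hlen _).2 h₂
    rw [map_mk_eq_mk_codeWord] at hgen
    have hc : codeWord e (l ++ a :: r) =
      codeWord e l ++ ((e a.1 : ℕ), a.2) :: codeWord e r := by simp [codeWord]
    rw [hc] at hred hgen ⊢
    refine mem_language_of_decomposition hred (fun b hb => ?_) (fun s hs => ?_) (fun s hs => ?_)
      hgen
    · rw [← hc] at hb
      obtain ⟨c, -, rfl⟩ := List.mem_map.1 hb
      rw [mem_signedLetters, List.length_map, hlen]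
      exact (e c.1).2
    · obtain ⟨s', hs', rfl⟩ := List.prefix_map_iff.1 hs
      exact map_mem_coreElements e (hl s' hs')
    · obtain ⟨s', hs', rfl⟩ := List.suffix_map_iff.1 hs
      have := map_mem_coreElements e (hr s' hs')
      rwa [_root_.map_inv] at this

theorem codeWord_injective : Function.Injective (codeWord e) := by
  refine List.map_injective_iff.2 fun p q h => ?_
  simp only [Prod.mk.injEq, Fin.val_inj, e.injective.eq_iff] at h
  exact Prod.ext h.1 h.2

theorem isRational_basisCompletions {α : Type u} {n : ℕ} (e : α ≃ Fin (n + 1))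
    (v : Fin n → List (α × Bool)) :
    IsRational (M := FreeMonoid (α × Bool)) (FreeMonoid.toList ⁻¹' basisCompletions v) := by
  have := Finite.of_equiv _ e.symm
  convert isRational_preimage_language
    (completionAutomaton (List.ofFn fun i => codeWord e (v i)))
    (fun p : α × Bool => ((e p.1 : ℕ), p.2)) using 1
  ext w
  rw [language_completionAutomaton]
  exact ((codeWord_injective e).mem_set_image (a := w.toList)).symm

end

theorem mainTheorem8 :
    -- `f` is the algorithm that constructs an automaton from the input words, uniformly in `|A|`
    ∃ f : List (List (ℕ × Bool)) → Automaton (ℕ × Bool), Computable f ∧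
      ∀ (α : Type u) (n : ℕ) (e : α ≃ Fin (n + 1)) (v : Fin n → List (α × Bool)),
        (∀ i, FreeGroup.IsReduced (v i)) →
        IsRational (M := FreeMonoid (α × Bool)) (FreeMonoid.toList ⁻¹' basisCompletions v) ∧
        Automaton.language (f (List.ofFn fun i => codeWord e (v i))) =
          codeWord e '' basisCompletions v ∧
        ∀ V : Subgroup (FreeGroup α),
          V = Subgroup.closure (Set.range fun i => FreeGroup.mk (v i)) →
          ∀ z ∈ basisCompletions v,
            basisCompletions v =
              {x | FreeGroup.IsReduced x ∧
                FreeGroup.mk x ∈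
                  (V : Set (FreeGroup α)) * {FreeGroup.mk z, (FreeGroup.mk z)⁻¹} *
                    (V : Set (FreeGroup α))} := by

  refine ⟨completionAutomaton, computable_completionAutomaton, fun α n e v _ =>
    ⟨isRational_basisCompletions e v, language_completionAutomaton e v, ?_⟩⟩
  rintro V rfl z hz
  rw [← wordSubgroup_ofFn]
  exact basisCompletions_eq e v z hz
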